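/- Let $\Omega=\{0,1\}^{\mathbb N}$ be the set of infinite binary sequences (paths) with the Cantor topology and its Borel $\sigma$-algebra, let $\mathbb S=\{0,1\}^*$ be the set of finite binary sequences (situations) with empty sequence $\square$, and for $A\subseteq\mathbb S$ let $[\![A]\!]\subseteq\Omega$ be the set of paths having an initial segment in $A$; write $[\![s]\!]=[\![\{s\}]\!]$ and $\omega_{1:n}$ for the initial segment of $\omega$ of length $n$. A forecasting system is a map $\varphi$ assigning to every $s\in\mathbb S$ a non-empty closed interval $\varphi(s)=[\underline\varphi(s),\overline\varphi(s)]\subseteq[0,1]$; it is precise if $\underline\varphi=\overline\varphi$, and computable if the real maps $\underline\varphi,\overline\varphi$ are computable, i.e. both they and their negatives are pointwise limits of non-decreasing recursive sequences of rational maps on $\mathbb S$. Write $\psi\subseteq\varphi$ if $\psi(s)\subseteq\varphi(s)$ for all $s$. A real process $M\colon\mathbb S\to\mathbb R$ is a supermartingale for $\varphi$ if $\max_{p\in\varphi(s)}\bigl[p\,(M(s1)-M(s))+(1-p)\,(M(s0)-M(s))\bigr]\le 0$ for all $s$, and a submartingale if $-M$ is a supermartingale. For $G\subseteq\Omega$ put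 $$\overline P^\varphi(G)=\inf\{M(\square): M\text{ a supermartingale for }\varphi,\ \liminf_n M(\omega_{1:n})\ge \mathbb I_G(\omega)\ \text{for all }\omega\in\Omega\},$$ $$\underline P^\varphi(G)=\sup\{M(\square): M\text{ a submartingale for }\varphi,\ \limsup_n M(\omega_{1:n})\le \mathbb I_G(\omega)\ \text{for all }\omega\in\Omega\}.$$ A precise forecasting system $\psi$ generates the Borel probability measure $\mu^{\psi}$ on $\Omega$ given by $\mu^{\psi}(G)=\underline P^{\psi}(G)=\overline P^{\psi}(G)$ for all Borel $G\subseteq\Omega$. Let $\mathcal M_\varphi=\{\mu^{\psi}:\psi\text{ precise},\ \psi\subseteq\varphi\}$. A path $\omega$ is Martin-Löf test random for $\varphi$ if $\omega\notin\bigcap_{n\ge0}[\![A_n]\!]$ for every recursively enumerable $A\subseteq\mathbb N_0\times\mathbb S$ such that $\overline P^\varphi([\![A_n]\!])\le2^{-n}$ for all $n\geq 0$, where $A_n=\{s:(n,s)\in A\}$. For a finite set $b\subset\mathbb Q\times\mathbb S\times\mathbb Q$, let $b(\Omega)$ be the set of all Borel probability measures $\mu$ on $\Omega$ with $u<\mu([\![s]\!])<v$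 for all $(u,s,v)\in b$. A class $\mathcal M$ of Borel probability measures is effectively compact if it is compact in the topology generated by the sets $b(\Omega)$ and the set of all finite sets $B$ of such $b$ with $\mathcal M\subseteq\bigcup_{b\in B}b(\Omega)$ is recursively enumerable. An $\mathcal M$-test is a map $\tau\colon\Omega\to[0,\infty]$ such that there is a recursively enumerable $B\subseteq\mathbb Q\times\mathbb S$ with $\{\omega:\tau(\omega)>r\}=[\![\{s:(r,s)\in B\}]\!]$ for all $r\in\mathbb Q$, and such that $\int\tau\,\mathrm d\mu\le1$ for all $\mu\in\mathcal M$. A path $\omega$ is uniformly random for an effectively compact class $\mathcal M$ if $\tau(\omega)<\infty$ for every $\mathcal M$-test $\tau$. **Theorem.** Let $\varphi$ be a computable forecasting system. Then $\mathcal M_\varphi$ is effectively compact, and a path $\omega\in\Omega$ is Martin-Löf test random for $\varphi$ if and only if it is uniformly random for $\mathcal M_\varphi$. -/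

import Mathlib

open MeasureTheory Filter
open scoped ENNReal

namespace ImpreciseRandomness

noncomputable section

/-! ### Paths and situations -/

/-- Situations: finite binary outcome sequences. `s ++ [x]` is the situation `s` followed by `x`. -/
abbrev Situation := List Bool

/-- Paths: infinite binary outcome sequences; `ω k` is the outcome at stage `k + 1`.
The topology is the (product) Cantor topology, the σ-algebra its Borel σ-algebra. -/
abbrev Path := ℕ → Bool

/-- The situation formed by the first `n` outcomes of the path `ω`. -/
def initial (ω : Path) (n : ℕ) : Situation := List.ofFn fun i : Fin n => ω i

/-- The set of all paths through the situation `s`. -/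
def cylinder (s : Situation) : Set Path := {ω | ∃ n, initial ω n = s}

/-- The set of all paths through some situation in `S`. -/
def cylinders (S : Set Situation) : Set Path := ⋃ s ∈ S, cylinder s

/-! ### Forecasting systems and supermartingales -/

/-- A forecasting system assigns to every situation a non-empty closed subinterval of `[0,1]`.
The order `ψ ≤ φ` is pointwise inclusion of intervals. -/
abbrev ForecastingSystem := Situation → NonemptyInterval unitInterval

/-- Precise forecasting systems: all interval forecasts are singletons. -/
def ForecastingSystem.IsPrecise (φ : ForecastingSystem) : Prop := ∀ s, (φ s).fst = (φ s).snd

/-- The expectation of the local gamble `f` associated with the precise forecast `p`. -/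
def localExp (p : unitInterval) (f : Bool → ℝ) : ℝ :=
  (p : ℝ) * f true + (1 - (p : ℝ)) * f false

/-- The local upper expectation `max_{p ∈ I} E_p(f)`. -/
def localUpperExp (I : NonemptyInterval unitInterval) (f : Bool → ℝ) : ℝ :=
  sSup ((fun p => localExp p f) '' (I : Set unitInterval))

/-- Supermartingales for `φ`: real processes whose differences have non-positive local upper
expectation. -/
def IsSupermartingale (φ : ForecastingSystem) (M : Situation → ℝ) : Prop :=
  ∀ s, localUpperExp (φ s) (fun x => M (s ++ [x]) - M s) ≤ 0

/-- Submartingales for `φ`. -/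
def IsSubmartingale (φ : ForecastingSystem) (M : Situation → ℝ) : Prop :=
  IsSupermartingale φ (fun s => -M s)

/-! ### Global upper and lower expectations -/

/-- The (unconditional) global upper expectation of a global gamble `g`: the infimum initial value
of the supermartingales whose limit inferior (an extended real number) dominates `g`. -/
def upperExp (φ : ForecastingSystem) (g : Path → ℝ) : ℝ :=
  sInf {a | ∃ M : Situation → ℝ, IsSupermartingale φ M ∧
    (∀ ω : Path, ((g ω : ℝ) : EReal) ≤ liminf (fun n => ((M (initial ω n) : ℝ) : EReal)) atTop) ∧
    M [] = a}

/-- The (unconditional) global lower expectation of a global gamble `g`. -/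
def lowerExp (φ : ForecastingSystem) (g : Path → ℝ) : ℝ :=
  sSup {a | ∃ M : Situation → ℝ, IsSubmartingale φ M ∧
    (∀ ω : Path, limsup (fun n => ((M (initial ω n) : ℝ) : EReal)) atTop ≤ ((g ω : ℝ) : EReal)) ∧
    M [] = a}

/-- The global upper probability of a global event. -/
def upperProb (φ : ForecastingSystem) (G : Set Path) : ℝ :=
  upperExp φ (G.indicator fun _ => 1)

/-- The global lower probability of a global event. -/
def lowerProb (φ : ForecastingSystem) (G : Set Path) : ℝ :=
  lowerExp φ (G.indicator fun _ => 1)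

/-- `μ` is the probability measure generated by the (precise) forecasting system `φ`: on all Borel
events, it is the common value of the upper and lower probabilities for `φ`. -/
def Generates (φ : ForecastingSystem) (μ : ProbabilityMeasure Path) : Prop :=
  ∀ G : Set Path, MeasurableSet G →
    lowerProb φ G = (μ : Measure Path).real G ∧ upperProb φ G = (μ : Measure Path).real G

/-- The class of all probability measures generated by the precise forecasting systems that are
compatible with `φ`. -/
def compatibleMeasures (φ : ForecastingSystem) : Set (ProbabilityMeasure Path) :=
  {μ | ∃ ψ : ForecastingSystem, ψ.IsPrecise ∧ ψ ≤ φ ∧ Generates ψ μ}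

/-! ### Computability -/

theorem primrecPred_reduced :
    PrimrecPred fun p : ℤ × ℕ => 0 < p.2 ∧ p.1.natAbs.Coprime p.2 := by
  have habs : Primrec Int.natAbs := by
    have h : Primrec fun z : ℤ => (Encodable.encode z + 1) / 2 :=
      Primrec.nat_div.comp (Primrec.succ.comp Primrec.encode) (Primrec.const 2)
    refine h.of_eq fun z => ?_
    cases z with
    | ofNat n => change (2 * n + 1) / 2 = n; omega
    | negSucc n => change (2 * n + 1 + 1) / 2 = n + 1; omega
  have hR : PrimrecRel fun (d : ℕ) (p : ℤ × ℕ) =>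
      p.1.natAbs % d = 0 → p.2 % d = 0 → d = 1 := by
    have h1 : PrimrecPred fun q : ℕ × (ℤ × ℕ) => q.2.1.natAbs % q.1 = 0 :=
      Primrec.eq.comp (Primrec.nat_mod.comp
        (habs.comp (Primrec.fst.comp Primrec.snd)) Primrec.fst) (Primrec.const 0)
    have h2 : PrimrecPred fun q : ℕ × (ℤ × ℕ) => q.2.2 % q.1 = 0 :=
      Primrec.eq.comp (Primrec.nat_mod.comp
        (Primrec.snd.comp Primrec.snd) Primrec.fst) (Primrec.const 0)
    have h3 : PrimrecPred fun q : ℕ × (ℤ × ℕ) => q.1 = 1 :=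
      Primrec.eq.comp Primrec.fst (Primrec.const 1)
    refine ((h1.not.or h2.not).or h3).of_eq fun q => ?_
    tauto
  have hall : PrimrecPred fun p : ℤ × ℕ =>
      ∀ d < p.2 + 1, p.1.natAbs % d = 0 → p.2 % d = 0 → d = 1 := by
    have h := PrimrecRel.forall_mem_list hR
    refine PrimrecPred.of_eq (h.comp (Primrec.list_range.comp
      (Primrec.succ.comp Primrec.snd)) Primrec.id) fun p => ?_
    simp only [List.mem_range, id, Nat.succ_eq_add_one]
  have hpos : PrimrecPred fun p : ℤ × ℕ => 0 < p.2 :=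
    Primrec.nat_lt.comp (Primrec.const 0) Primrec.snd
  refine (hpos.and hall).of_eq fun p => and_congr_right fun hp => ⟨fun h => ?_, fun h d _ h1 h2 => ?_⟩
  · exact h _ (Nat.lt_succ_of_le (Nat.gcd_le_right _ hp))
      (Nat.mod_eq_zero_of_dvd (Nat.gcd_dvd_left _ _))
      (Nat.mod_eq_zero_of_dvd (Nat.gcd_dvd_right _ _))
  · exact Nat.eq_one_of_dvd_coprimes h (Nat.dvd_of_mod_eq_zero h1) (Nat.dvd_of_mod_eq_zero h2)

/-- A rational number amounts to a reduced fraction. -/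
def ratEquivReduced : ℚ ≃ {p : ℤ × ℕ // 0 < p.2 ∧ p.1.natAbs.Coprime p.2} where
  toFun q := ⟨(q.num, q.den), q.den_pos, q.reduced⟩
  invFun p := ⟨p.1.1, p.1.2, p.2.1.ne', p.2.2⟩
  left_inv _ := rfl
  right_inv _ := rfl

/-- The effective encoding of rational numbers: encode the pair (numerator, denominator) of the
reduced fraction. -/
instance primcodableRat : Primcodable ℚ :=
  letI : Primcodable {p : ℤ × ℕ // 0 < p.2 ∧ p.1.natAbs.Coprime p.2} :=
    Primcodable.subtype primrecPred_reduced
  Primcodable.ofEquiv _ ratEquivReduced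

/-- Recursively enumerable sets of (effectively encoded) objects. -/
def IsRE {D : Type*} [Primcodable D] (A : Set D) : Prop := REPred fun d => d ∈ A

/-- `r` is lower semicomputable: it is the pointwise limit of a non-decreasing recursive sequence
of rational maps. -/
def LowerSemicomputable {D : Type*} [Primcodable D] (r : D → ℝ) : Prop :=
  ∃ q : D × ℕ → ℚ, Computable q ∧ (∀ d n, q (d, n) ≤ q (d, n + 1)) ∧
    ∀ d, Tendsto (fun n => ((q (d, n) : ℚ) : ℝ)) atTop (nhds (r d))

/-- `r` is upper semicomputable. -/
def UpperSemicomputable {D : Type*} [Primcodable D] (r : D → ℝ) : Prop :=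
  LowerSemicomputable fun d => -r d

/-- `r` is a computable real map. -/
def ComputableReal {D : Type*} [Primcodable D] (r : D → ℝ) : Prop :=
  LowerSemicomputable r ∧ UpperSemicomputable r

/-- A forecasting system is computable if its lower and upper bounds are computable. -/
def ForecastingSystem.IsComputable (φ : ForecastingSystem) : Prop :=
  ComputableReal (fun s => ((φ s).fst : ℝ)) ∧ ComputableReal (fun s => ((φ s).snd : ℝ))

/-- The sets `G d` are effectively open, effectively in `d`. -/
def EffectivelyOpenIn {D : Type*} [Primcodable D] (G : D → Set Path) : Prop :=
  ∃ A : Set (D × Situation), IsRE A ∧ ∀ d, G d = cylinders {s | (d, s) ∈ A}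

/-! ### Martin-Löf test randomness -/

/-- `A` represents a Martin-Löf test for `φ`. -/
def IsMartinLofTest (φ : ForecastingSystem) (A : Set (ℕ × Situation)) : Prop :=
  IsRE A ∧ ∀ n, upperProb φ (cylinders {s | (n, s) ∈ A}) ≤ (2 : ℝ)⁻¹ ^ n

/-- `ω` is Martin-Löf test random for `φ`. -/
def MartinLofTestRandom (φ : ForecastingSystem) (ω : Path) : Prop :=
  ∀ A : Set (ℕ × Situation), IsMartinLofTest φ A → ω ∉ ⋂ n, cylinders {s | (n, s) ∈ A}

/-! ### Effective compactness and uniform randomness -/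

/-- Generators of basic open sets of probability measures: finite sets of triples `(u, s, v)`. -/
abbrev Generator := Finset (ℚ × Situation × ℚ)

/-- The basic open set of all `μ` with `u < μ(cylinder s) < v` for all `(u, s, v) ∈ b`. -/
def basicOpen (b : Generator) : Set (ProbabilityMeasure Path) :=
  {μ | ∀ c ∈ b, (c.1 : ℝ) < (μ : Measure Path).real (cylinder c.2.1) ∧
    (μ : Measure Path).real (cylinder c.2.1) < (c.2.2 : ℝ)}

/-- The topology on the set of probability measures that is generated by the basic open sets. -/
abbrev measureTopology : TopologicalSpace (ProbabilityMeasure Path) :=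
  TopologicalSpace.generateFrom (Set.range basicOpen)

/-- The finite sets of generators whose basic open sets cover the class `K`. -/
def finiteCovers (K : Set (ProbabilityMeasure Path)) : Set (Finset Generator) :=
  {B | K ⊆ ⋃ b ∈ B, basicOpen b}

/-- `K` is effectively compact: it is compact, and its finite covers by basic open sets can be
recursively enumerated. Here finite sets are encoded by (arbitrary) lists of their elements. -/
def EffectivelyCompact (K : Set (ProbabilityMeasure Path)) : Prop :=
  @IsCompact _ measureTopology K ∧
    IsRE {L : List (List (ℚ × Situation × ℚ)) | (L.map List.toFinset).toFinset ∈ finiteCovers K}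

/-- `τ` is a `K`-test: the sets `{τ > r}` are effectively open, effectively in the rational `r`
(the comparison is made in the extended real numbers), and `τ` has integral at most one for all
measures in `K`. -/
def IsUniformTest (K : Set (ProbabilityMeasure Path)) (τ : Path → ℝ≥0∞) : Prop :=
  EffectivelyOpenIn (fun r : ℚ => {ω | (((r : ℚ) : ℝ) : EReal) < ((τ ω : ℝ≥0∞) : EReal)}) ∧
    ∀ μ ∈ K, ∫⁻ ω, τ ω ∂(μ : Measure Path) ≤ 1

/-- `ω` is uniformly random for the (effectively compact) class `K`. -/
def UniformlyRandom (K : Set (ProbabilityMeasure Path)) (ω : Path) : Prop :=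
  ∀ τ : Path → ℝ≥0∞, IsUniformTest K τ → τ ω < ∞

end

end ImpreciseRandomness

namespace ImpreciseRandomness

/-! ### Cylinders -/

/-! Everything is expressed through cylinder masses. A measure belongs to the class exactly when its
mass function `v` satisfies `φ.fst * v s ≤ v (s ++ [true]) ≤ φ.snd * v s` at every `s`
(`mem_compatibleMeasures_iff`). These are closed linear constraints on a subset of the compact cube
of functions from situations to `[0,1]`, which gives compactness.

For effectivity, masses are rounded to a grid with denominator `N`, and only situations with code
below `N` are considered. A finite family of basic open sets covers the class if and only if, for
some `N`, each of the finitely many grid points visibly violates a constraint or lies safely inside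
a member of the family (`mem_finiteCovers_compatibleMeasures_iff`). This can be searched for.
Completeness of the search is a compactness argument: grid points that defeat every `N` have a
limit, which is a compatible measure outside the cover.

The two notions of randomness are linked by the fact that the upper probability of an open set is
the supremum of its probabilities under compatible measures. Fatou's lemma bounds each probability
by the upper probability (`IsCompatible.measure_le_upperProb`). Conversely, the probability of
reaching a set of situations within `K` steps is maximised by a measure that always selects an
endpoint of the interval (`upperProb_cylinders_le_of_forall`). Then Markov's inequality turns a
uniform test into a Martin-Löf test, and a weighted supremum of indicators turns a Martin-Löf test
into a uniform test. -/

theorem initial_succ (ω : Path) (n : ℕ) : initial ω (n + 1) = initial ω n ++ [ω n] := by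
  rw [initial, List.ofFn_succ_last]
  rfl

@[simp] theorem length_initial (ω : Path) (n : ℕ) : (initial ω n).length = n := by
  simp [initial]

theorem mem_cylinder {ω : Path} {s : Situation} : ω ∈ cylinder s ↔ initial ω s.length = s := by
  refine ⟨?_, fun h => ⟨_, h⟩⟩
  rintro ⟨n, rfl⟩
  simp

@[simp] theorem cylinder_nil : cylinder [] = Set.univ :=
  Set.eq_univ_of_forall fun _ => ⟨0, rfl⟩

theorem mem_cylinder_append {ω : Path} {s : Situation} {x : Bool} :
    ω ∈ cylinder (s ++ [x]) ↔ ω ∈ cylinder s ∧ ω s.length = x := by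
  rw [mem_cylinder, mem_cylinder, List.length_append, List.length_singleton, initial_succ]
  constructor
  · intro h
    obtain ⟨h1, h2⟩ := List.append_inj' h rfl
    exact ⟨h1, List.singleton_injective h2⟩
  · rintro ⟨h1, h2⟩
    rw [h1, h2]

theorem cylinder_eq_union (s : Situation) :
    cylinder s = cylinder (s ++ [false]) ∪ cylinder (s ++ [true]) := by
  ext ω
  rw [Set.mem_union, mem_cylinder_append, mem_cylinder_append]
  cases ω s.length <;> simp

theorem disjoint_cylinder (s : Situation) :
    Disjoint (cylinder (s ++ [false])) (cylinder (s ++ [true])) := by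
  rw [Set.disjoint_left]
  intro ω h0 h1
  rw [mem_cylinder_append] at h0 h1
  simp_all

theorem isOpen_cylinder (s : Situation) : IsOpen (cylinder s) := by
  induction s using List.reverseRecOn with
  | nil => simp
  | append_singleton s x ih =>
    have h : cylinder (s ++ [x]) = cylinder s ∩ (fun ω : Path => ω s.length) ⁻¹' {x} := by
      ext ω
      exact mem_cylinder_append
    rw [h]
    exact ih.inter ((isOpen_discrete _).preimage (continuous_apply _))

theorem measurableSet_cylinder (s : Situation) : MeasurableSet (cylinder s) :=
  (isOpen_cylinder s).measurableSet

theorem isOpen_cylinders (S : Set Situation) : IsOpen (cylinders S) :=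
  isOpen_biUnion fun s _ => isOpen_cylinder s

theorem mem_cylinders {S : Set Situation} {ω : Path} :
    ω ∈ cylinders S ↔ ∃ n, initial ω n ∈ S := by
  simp only [cylinders, Set.mem_iUnion, exists_prop]
  constructor
  · rintro ⟨s, hs, n, rfl⟩
    exact ⟨n, hs⟩
  · rintro ⟨n, hn⟩
    exact ⟨_, hn, n, rfl⟩

theorem apply_eq_of_mem_cylinder_initial {ω η : Path} {n i : ℕ} (h : η ∈ cylinder (initial ω n))
    (hi : i < n) : η i = ω i := by
  rw [mem_cylinder, length_initial] at h
  exact congrFun (List.ofFn_injective h) ⟨i, hi⟩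

theorem exists_cylinders_eq {U : Set Path} (hU : IsOpen U) : ∃ S, U = cylinders S := by
  refine ⟨{s | cylinder s ⊆ U}, Set.Subset.antisymm (fun ω hω => ?_) (Set.iUnion₂_subset fun s hs => hs)⟩
  obtain ⟨_, ⟨η, n, rfl⟩, h, hsub⟩ :=
    (PiNat.isTopologicalBasis_cylinders fun _ => Bool).exists_subset_of_mem_open hω hU
  refine mem_cylinders.2 ⟨n, fun ζ hζ => hsub fun i hi => ?_⟩
  rw [apply_eq_of_mem_cylinder_initial hζ hi, h i hi]

theorem measurable_comp_initial {β : Type*} [MeasurableSpace β] (f : Situation → β) (n : ℕ) :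
    Measurable fun ω : Path => f (initial ω n) := by
  have h : Measurable fun ω : Path => fun i : Fin n => ω i :=
    measurable_pi_lambda _ fun i => measurable_pi_apply _
  exact (measurable_of_countable fun g : Fin n → Bool => f (List.ofFn g)).comp h

/-! ### Probability measures with prescribed cylinder masses -/

/-- `v` assigns to every situation a mass that is split among its two children. -/
def IsMassFunction (v : Situation → ℝ) : Prop :=
  v [] = 1 ∧ ∀ s, 0 ≤ v s ∧ v s = v (s ++ [false]) + v (s ++ [true])

/-- The total mass of the situations to the left of `t ++ s` that pass through `t`. -/
noncomputable def massLeft (v : Situation → ℝ) : Situation → Situation → ℝ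
  | _, [] => 0
  | t, x :: s => (if x then v (t ++ [false]) else 0) + massLeft v (t ++ [x]) s

theorem massLeft_append (v : Situation → ℝ) (t s : Situation) (x : Bool) :
    massLeft v t (s ++ [x]) = massLeft v t s + if x then v (t ++ s ++ [false]) else 0 := by
  induction s generalizing t with
  | nil => simp [massLeft]
  | cons y s ih =>
    rw [List.cons_append, massLeft, massLeft, ih]
    simp [add_assoc]

/-- The situation of length `n` whose mass interval contains the number `r`. -/
noncomputable def quantileSituation (v : Situation → ℝ) (r : ℝ) : ℕ → Situation
  | 0 => []
  | n + 1 => quantileSituation v r n ++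
      [decide (massLeft v [] (quantileSituation v r n) +
        v (quantileSituation v r n ++ [false]) ≤ r)]

/-- The path whose initial segments have mass intervals containing `r`. -/
noncomputable def quantilePath (v : Situation → ℝ) (r : ℝ) : Path := fun n =>
  decide (massLeft v [] (quantileSituation v r n) + v (quantileSituation v r n ++ [false]) ≤ r)

theorem initial_quantilePath (v : Situation → ℝ) (r : ℝ) (n : ℕ) :
    initial (quantilePath v r) n = quantileSituation v r n := by
  induction n with
  | zero => rfl
  | succ n ih => rw [initial_succ, ih]; rfl

theorem measurable_quantilePath (v : Situation → ℝ) : Measurable (quantilePath v) := by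
  let : MeasurableSpace Situation := ⊤
  have : MeasurableSingletonClass Situation := ⟨fun _ => trivial⟩
  have hdec : Measurable fun p : Situation × ℝ =>
      decide (massLeft v [] p.1 + v (p.1 ++ [false]) ≤ p.2) := by
    refine measurable_from_prod_countable_right fun s => ?_
    refine measurable_to_bool ?_
    convert measurableSet_Ici (a := massLeft v [] s + v (s ++ [false])) using 1
    ext r
    simp
  have hsit : ∀ n, Measurable fun r => quantileSituation v r n := by
    intro n
    induction n with
    | zero => exact measurable_const
    | succ n ih =>
      exact (measurable_of_countable (fun p : Situation × Bool => p.1 ++ [p.2])).comp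
        (ih.prodMk (hdec.comp (ih.prodMk measurable_id)))
  exact measurable_pi_lambda _ fun n => hdec.comp ((hsit n).prodMk measurable_id)

/-- The half-open mass interval of `s` is cut at `massLeft v [] s + v (s ++ [false])`: numbers to
the left continue with `false`, the others with `true`. Situations of mass zero get empty intervals,
so they need no special treatment. -/
theorem quantilePath_mem_cylinder_iff {v : Situation → ℝ} (hv : IsMassFunction v)
    (s : Situation) (r : ℝ) :
    r ∈ Set.Ico (0 : ℝ) 1 ∧ quantilePath v r ∈ cylinder s ↔
      massLeft v [] s ≤ r ∧ r < massLeft v [] s + v s := by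
  induction s using List.reverseRecOn with
  | nil => simp [massLeft, hv.1]
  | append_singleton s x ih =>
    rw [mem_cylinder_append, ← and_assoc, ih, massLeft_append]
    have h : quantilePath v r s.length = x ∧ quantilePath v r ∈ cylinder s ↔
      decide (massLeft v [] s + v (s ++ [false]) ≤ r) = x ∧ quantilePath v r ∈ cylinder s := by
      refine and_congr_left fun hs => ?_
      rw [mem_cylinder, initial_quantilePath] at hs
      rw [quantilePath, hs]
    have h' := (hv.2 s).2
    have h0 := (hv.2 (s ++ [false])).1
    have h1 := (hv.2 (s ++ [true])).1
    constructor
    · rintro ⟨h2, h3⟩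
      have := (h.1 ⟨h3, (ih.2 h2).2⟩).1
      cases x
      · simp only [decide_eq_false_iff_not, not_le] at this
        simp; grind
      · simp only [decide_eq_true_eq] at this
        simp; grind
    · rintro ⟨h2, h3⟩
      have h4 : massLeft v [] s ≤ r ∧ r < massLeft v [] s + v s := by
        cases x <;> simp at h2 h3 <;> grind
      refine ⟨h4, (h.2 ⟨?_, (ih.2 h4).2⟩).1⟩
      cases x <;> simp at h2 h3 ⊢ <;> grind

/-- The measure is the law of the quantile path of a uniformly distributed number in `[0,1)`: the
numbers whose path goes through `s` form an interval of length `v s`. -/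
theorem IsMassFunction.exists_measure {v : Situation → ℝ} (hv : IsMassFunction v) :
    ∃ μ : ProbabilityMeasure Path, ∀ s, (μ : Measure Path).real (cylinder s) = v s := by
  have hcyl : ∀ s, (volume.restrict (Set.Ico (0 : ℝ) 1)).map (quantilePath v) (cylinder s) =
      ENNReal.ofReal (v s) := by
    intro s
    rw [Measure.map_apply (measurable_quantilePath v) (measurableSet_cylinder s),
      Measure.restrict_apply' measurableSet_Ico, Set.inter_comm]
    have : Set.Ico (0 : ℝ) 1 ∩ quantilePath v ⁻¹' cylinder s =
        Set.Ico (massLeft v [] s) (massLeft v [] s + v s) :=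
      Set.ext fun r => quantilePath_mem_cylinder_iff hv s r
    rw [this, Real.volume_Ico, add_sub_cancel_left]
  refine ⟨⟨(volume.restrict (Set.Ico (0 : ℝ) 1)).map (quantilePath v), ⟨?_⟩⟩, fun s => ?_⟩
  · rw [← cylinder_nil, hcyl, hv.1, ENNReal.ofReal_one]
  · rw [ProbabilityMeasure.coe_mk, measureReal_def, hcyl, ENNReal.toReal_ofReal (hv.2 s).1]

theorem isMassFunction_measure (μ : ProbabilityMeasure Path) :
    IsMassFunction fun s => (μ : Measure Path).real (cylinder s) := by
  refine ⟨by simp, fun s => ⟨measureReal_nonneg, ?_⟩⟩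
  rw [← measureReal_union (disjoint_cylinder s) (measurableSet_cylinder _), ← cylinder_eq_union]

/-! ### Supermartingales -/

theorem coe_le_liminf_coe_iff {m : ℕ → ℝ} {c : ℝ} :
    (c : EReal) ≤ liminf (fun n => (m n : EReal)) atTop ↔
      ∀ e > 0, ∀ᶠ n in atTop, c - e < m n := by
  rw [le_liminf_iff]
  constructor
  · intro h e he
    filter_upwards [h (c - e : ℝ) (EReal.coe_lt_coe_iff.2 (sub_lt_self c he))] with n hn
    exact EReal.coe_lt_coe_iff.1 hn
  · intro h y hy
    obtain ⟨r, hr, hrc⟩ := EReal.lt_iff_exists_real_btwn.1 hy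
    filter_upwards [h (c - r) (sub_pos.2 (EReal.coe_lt_coe_iff.1 hrc))] with n hn
    exact hr.trans (EReal.coe_lt_coe_iff.2 (by linarith))

theorem limsup_coe_le_coe_iff {m : ℕ → ℝ} {c : ℝ} :
    limsup (fun n => (m n : EReal)) atTop ≤ (c : EReal) ↔
      ∀ e > 0, ∀ᶠ n in atTop, m n < c + e := by
  rw [limsup_le_iff]
  constructor
  · intro h e he
    filter_upwards [h (c + e : ℝ) (EReal.coe_lt_coe_iff.2 (lt_add_of_pos_right c he))] with n hn
    exact EReal.coe_lt_coe_iff.1 hn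
  · intro h y hy
    obtain ⟨r, hrc, hr⟩ := EReal.lt_iff_exists_real_btwn.1 hy
    filter_upwards [h (r - c) (sub_pos.2 (EReal.coe_lt_coe_iff.1 hrc))] with n hn
    exact (EReal.coe_lt_coe_iff.2 (by linarith)).trans hr

theorem localExp_le_localUpperExp {I : NonemptyInterval unitInterval} {p : unitInterval}
    (hp : p ∈ I) (f : Bool → ℝ) : localExp p f ≤ localUpperExp I f := by
  refine le_csSup ?_ (Set.mem_image_of_mem _ hp)
  have hc : Continuous fun p : unitInterval => localExp p f := by
    unfold localExp
    fun_prop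
  exact ((isCompact_univ.image hc).bddAbove).mono (Set.image_mono (Set.subset_univ _))

theorem localUpperExp_le_iff {I : NonemptyInterval unitInterval} {f : Bool → ℝ} {c : ℝ} :
    localUpperExp I f ≤ c ↔ ∀ p ∈ I, localExp p f ≤ c := by
  refine ⟨fun h p hp => (localExp_le_localUpperExp hp f).trans h, fun h => ?_⟩
  exact csSup_le ⟨_, Set.mem_image_of_mem _ (show I.fst ∈ I from ⟨le_rfl, I.fst_le_snd⟩)⟩
    (Set.forall_mem_image.2 h)

theorem isSupermartingale_iff {φ : ForecastingSystem} {M : Situation → ℝ} :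
    IsSupermartingale φ M ↔
      ∀ s, ∀ p ∈ φ s, (p : ℝ) * M (s ++ [true]) + (1 - p) * M (s ++ [false]) ≤ M s := by
  refine forall_congr' fun s => localUpperExp_le_iff.trans (forall₂_congr fun p _ => ?_)
  rw [localExp]
  constructor <;> intro h <;> linarith

theorem IsSupermartingale.exists_child_le {φ : ForecastingSystem} {M : Situation → ℝ}
    (hM : IsSupermartingale φ M) (s : Situation) : ∃ x, M (s ++ [x]) ≤ M s := by
  by_contra! h
  have h1 := isSupermartingale_iff.1 hM s (φ s).fst ⟨le_rfl, (φ s).fst_le_snd⟩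
  have h2 := h true
  have h3 := h false
  have h4 := (φ s).fst.2.1
  have h5 := (φ s).fst.2.2
  have h6 := mul_nonneg h4 (sub_nonneg.2 h2.le)
  have h7 := mul_nonneg (sub_nonneg.2 h5) (sub_nonneg.2 h3.le)
  -- One of the two weights is at least `1 / 2`, so one of the strict inequalities survives in the
  -- weighted average.
  rcases le_total ((φ s).fst : ℝ) (1 / 2) with h | h
  · nlinarith
  · nlinarith

/-- Every situation lies on a path along which a supermartingale does not increase afterwards. -/
theorem IsSupermartingale.exists_path {φ : ForecastingSystem} {M : Situation → ℝ}
    (hM : IsSupermartingale φ M) (s : Situation) :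
    ∃ ω : Path, ∀ k, M (initial ω (s.length + k)) ≤ M s := by
  choose x hx using hM.exists_child_le
  let S : ℕ → Situation := fun k => Nat.rec s (fun _ t => t ++ [x t]) k
  have hS : ∀ k, S (k + 1) = S k ++ [x (S k)] := fun k => rfl
  have hlen : ∀ k, (S k).length = s.length + k := by
    intro k
    induction k with
    | zero => rfl
    | succ k ih => rw [hS, List.length_append, ih]; rfl
  have hle : ∀ k, M (S k) ≤ M s := by
    intro k
    induction k with
    | zero => exact le_rfl
    | succ k ih => exact (hS k ▸ hx (S k)).trans ih
  let ω : Path := fun n => if h : n < s.length then s[n] else x (S (n - s.length))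
  have h0 : initial ω s.length = s := by
    apply List.ext_getElem (by simp)
    intro i h1 h2
    simp [initial, ω]
  have hω : ∀ k, initial ω (s.length + k) = S k := by
    intro k
    induction k with
    | zero => exact h0
    | succ k ih => rw [← add_assoc, initial_succ, ih, hS]; simp [ω]
  exact ⟨ω, fun k => hω k ▸ hle k⟩

/-- Along a path through `s` on which `M` never again exceeds `M s`, the limit inferior is at most
`M s`. With `c = 0` this makes the supermartingales defining `upperProb` non-negative, so that the
real `sInf` is taken over a set bounded below. -/
theorem IsSupermartingale.le_of_le_liminf {φ : ForecastingSystem} {M : Situation → ℝ}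
    (hM : IsSupermartingale φ M) {c : ℝ}
    (h : ∀ ω : Path, (c : EReal) ≤ liminf (fun n => ((M (initial ω n) : ℝ) : EReal)) atTop)
    (s : Situation) : c ≤ M s := by
  obtain ⟨ω, hω⟩ := hM.exists_path s
  refine EReal.coe_le_coe_iff.1 ((h ω).trans ?_)
  refine liminf_le_of_frequently_le' (Eventually.frequently ?_)
  filter_upwards [eventually_ge_atTop s.length] with n hn
  obtain ⟨k, rfl⟩ := Nat.exists_eq_add_of_le hn
  exact EReal.coe_le_coe_iff.2 (hω k)

/-! ### Properties of the global upper probability -/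

/-- The initial values of the supermartingales that enter the definition of `upperProb`. -/
def upperProbValues (φ : ForecastingSystem) (G : Set Path) : Set ℝ :=
  {a | ∃ M : Situation → ℝ, IsSupermartingale φ M ∧
    (∀ ω : Path, ((G.indicator (fun _ => (1 : ℝ)) ω : ℝ) : EReal) ≤
      liminf (fun n => ((M (initial ω n) : ℝ) : EReal)) atTop) ∧
    M [] = a}

theorem upperProb_eq (φ : ForecastingSystem) (G : Set Path) :
    upperProb φ G = sInf (upperProbValues φ G) := rfl

theorem upperProbValues_nonneg {φ : ForecastingSystem} {G : Set Path} {a : ℝ}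
    (ha : a ∈ upperProbValues φ G) : 0 ≤ a := by
  obtain ⟨M, hM, h, rfl⟩ := ha
  refine hM.le_of_le_liminf (fun ω => le_trans ?_ (h ω)) _
  exact EReal.coe_le_coe_iff.2 (Set.indicator_nonneg (fun _ _ => zero_le_one) _)

theorem bddBelow_upperProbValues (φ : ForecastingSystem) (G : Set Path) :
    BddBelow (upperProbValues φ G) := ⟨0, fun _ => upperProbValues_nonneg⟩

theorem one_mem_upperProbValues (φ : ForecastingSystem) (G : Set Path) :
    1 ∈ upperProbValues φ G := by
  refine ⟨fun _ => 1, isSupermartingale_iff.2 fun s p _ => by linarith, fun ω => ?_, rfl⟩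
  rw [liminf_const]
  exact EReal.coe_le_coe_iff.2 (Set.indicator_le_self' (fun _ _ => zero_le_one) _)

theorem upperProb_mono_right (φ : ForecastingSystem) {G H : Set Path} (h : G ⊆ H) :
    upperProb φ G ≤ upperProb φ H :=
  csInf_le_csInf (bddBelow_upperProbValues φ G) ⟨1, one_mem_upperProbValues φ H⟩
    fun _ ⟨M, hM, hl, h0⟩ => ⟨M, hM, fun ω => le_trans (EReal.coe_le_coe_iff.2
      (Set.indicator_le_indicator_of_subset h (fun _ => zero_le_one) ω)) (hl ω), h0⟩

/-- The map `M ↦ 1 - M` exchanges the submartingales below the indicator of `G` with the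
supermartingales above that of its complement, so only upper probabilities need study. -/
theorem lowerProb_eq (φ : ForecastingSystem) (G : Set Path) :
    lowerProb φ G = 1 - upperProb φ Gᶜ := by
  have key : ∀ a : ℝ, (∃ M : Situation → ℝ, IsSubmartingale φ M ∧
      (∀ ω : Path, limsup (fun n => ((M (initial ω n) : ℝ) : EReal)) atTop ≤
        ((G.indicator (fun _ => (1 : ℝ)) ω : ℝ) : EReal)) ∧ M [] = a) ↔
      1 - a ∈ upperProbValues φ Gᶜ := by
    intro a
    have hG : ∀ ω, Gᶜ.indicator (fun _ => (1 : ℝ)) ω = 1 - G.indicator (fun _ => (1 : ℝ)) ω := by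
      intro ω
      by_cases h : ω ∈ G <;> simp [h]
    constructor
    · rintro ⟨M, hM, h, rfl⟩
      refine ⟨fun s => 1 - M s, isSupermartingale_iff.2 fun s p hp => ?_, fun ω => ?_, rfl⟩
      · linarith [isSupermartingale_iff.1 hM s p hp]
      · rw [hG, coe_le_liminf_coe_iff]
        intro e he
        filter_upwards [limsup_coe_le_coe_iff.1 (h ω) e he] with n hn
        linarith
    · rintro ⟨M, hM, h, h0⟩
      refine ⟨fun s => 1 - M s, isSupermartingale_iff.2 fun s p hp => ?_, fun ω => ?_, ?_⟩
      · linarith [isSupermartingale_iff.1 hM s p hp]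
      · rw [limsup_coe_le_coe_iff]
        intro e he
        have h' := h ω
        rw [hG, coe_le_liminf_coe_iff] at h'
        filter_upwards [h' e he] with n hn
        linarith
      · linarith
  have hset : {a : ℝ | 1 - a ∈ upperProbValues φ Gᶜ} = (fun a => 1 - a) '' upperProbValues φ Gᶜ := by
    ext a
    constructor
    · exact fun h => ⟨1 - a, h, sub_sub_cancel 1 a⟩
    · rintro ⟨b, hb, rfl⟩
      rwa [Set.mem_ofPred_eq, sub_sub_cancel]
  rw [lowerProb, lowerExp]
  simp only [key]
  rw [hset, upperProb_eq]
  have hglb : IsGLB (upperProbValues φ Gᶜ) (sInf (upperProbValues φ Gᶜ)) :=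
    isGLB_csInf ⟨1, one_mem_upperProbValues φ Gᶜ⟩ (bddBelow_upperProbValues φ Gᶜ)
  refine IsLUB.csSup_eq ⟨?_, fun b hb => ?_⟩ (Set.Nonempty.image _ ⟨1, one_mem_upperProbValues φ Gᶜ⟩)
  · rintro _ ⟨a, ha, rfl⟩
    exact sub_le_sub_left (hglb.1 ha) 1
  · have : 1 - b ≤ sInf (upperProbValues φ Gᶜ) := hglb.2 fun a ha => by
      linarith [hb (Set.mem_image_of_mem _ ha)]
    linarith

/-! ### Measures whose conditional probabilities lie in the interval forecasts -/

/-- The conditional probabilities of the mass function `v` lie in the interval forecasts of `φ`. -/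
def IsCompatible (φ : ForecastingSystem) (v : Situation → ℝ) : Prop :=
  IsMassFunction v ∧ ∀ s, ((φ s).fst : ℝ) * v s ≤ v (s ++ [true]) ∧
    v (s ++ [true]) ≤ ((φ s).snd : ℝ) * v s

/-- The mass that a measure assigns to the paths through a situation. -/
noncomputable def cylinderMass (μ : ProbabilityMeasure Path) (s : Situation) : ℝ :=
  (μ : Measure Path).real (cylinder s)

theorem IsCompatible.mono {φ ψ : ForecastingSystem} {v : Situation → ℝ} (h : ψ ≤ φ)
    (hv : IsCompatible ψ v) : IsCompatible φ v :=
  ⟨hv.1, fun s => ⟨(mul_le_mul_of_nonneg_right (Subtype.coe_le_coe.2 (h s).1) (hv.1.2 s).1).trans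
    (hv.2 s).1,
    (hv.2 s).2.trans (mul_le_mul_of_nonneg_right (Subtype.coe_le_coe.2 (h s).2) (hv.1.2 s).1)⟩⟩

/-- A compatible mass function is obtained by selecting precise forecasts from the intervals. -/
theorem IsCompatible.exists_forecast {φ : ForecastingSystem} {v : Situation → ℝ}
    (hv : IsCompatible φ v) (s : Situation) : ∃ p ∈ φ s, v (s ++ [true]) = p * v s := by
  obtain ⟨h1, h2⟩ := hv.2 s
  -- At mass zero the child also has mass zero and any forecast serves; otherwise the forecast is
  -- the conditional probability.
  rcases (hv.1.2 s).1.eq_or_lt with h | h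
  · refine ⟨(φ s).fst, ⟨le_rfl, (φ s).fst_le_snd⟩, ?_⟩
    rw [← h] at h1 h2 ⊢
    linarith
  · have h3 : ((φ s).fst : ℝ) ≤ v (s ++ [true]) / v s := (le_div_iff₀ h).2 h1
    have h4 : v (s ++ [true]) / v s ≤ ((φ s).snd : ℝ) := (div_le_iff₀ h).2 h2
    exact ⟨⟨v (s ++ [true]) / v s, (φ s).fst.2.1.trans h3, h4.trans (φ s).snd.2.2⟩, ⟨h3, h4⟩,
      (div_mul_cancel₀ _ h.ne').symm⟩

theorem IsCompatible.mass_mul_le {φ : ForecastingSystem} {v : Situation → ℝ}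
    (hv : IsCompatible φ v) {M : Situation → ℝ} (hM : IsSupermartingale φ M) (s : Situation) :
    v (s ++ [false]) * M (s ++ [false]) + v (s ++ [true]) * M (s ++ [true]) ≤ v s * M s := by
  obtain ⟨p, hp, h⟩ := hv.exists_forecast s
  have h1 := mul_le_mul_of_nonneg_left (isSupermartingale_iff.1 hM s p hp) (hv.1.2 s).1
  have h2 := (hv.1.2 s).2
  have h3 : v (s ++ [false]) = (1 - p) * v s := by linarith
  rw [h3, h]
  linarith

theorem ofReal_cylinderMass (μ : ProbabilityMeasure Path) (s : Situation) :
    ENNReal.ofReal (cylinderMass μ s) = (μ : Measure Path) (cylinder s) :=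
  ofReal_measureReal

theorem lintegral_supermartingale_le {φ : ForecastingSystem} {μ : ProbabilityMeasure Path}
    (hμ : IsCompatible φ (cylinderMass μ)) {M : Situation → ℝ} (hM : IsSupermartingale φ M)
    (h0 : ∀ s, 0 ≤ M s) (n : ℕ) (s : Situation) :
    ∫⁻ ω in cylinder s, ENNReal.ofReal (M (initial ω (s.length + n))) ∂(μ : Measure Path) ≤
      ENNReal.ofReal (cylinderMass μ s * M s) := by
  induction n generalizing s with
  | zero =>
    rw [setLIntegral_congr_fun (g := fun _ => ENNReal.ofReal (M s)) (measurableSet_cylinder s)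
      fun ω hω => by simp only [add_zero, mem_cylinder.1 hω], setLIntegral_const,
      ← ofReal_cylinderMass, mul_comm, ENNReal.ofReal_mul (hμ.1.2 s).1]
  | succ n ih =>
    have h : ∀ x, s.length + (n + 1) = (s ++ [x]).length + n := fun x => by
      rw [List.length_append, List.length_singleton, add_assoc, add_comm 1]
    rw [cylinder_eq_union, lintegral_union (measurableSet_cylinder _) (disjoint_cylinder s)]
    nth_rewrite 1 [h false]
    rw [h true]
    refine (add_le_add (ih _) (ih _)).trans ?_
    rw [← ENNReal.ofReal_add (mul_nonneg (hμ.1.2 _).1 (h0 _)) (mul_nonneg (hμ.1.2 _).1 (h0 _))]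
    exact ENNReal.ofReal_le_ofReal (hμ.mass_mul_le hM s)

/-- A supermartingale for `φ` is non-increasing in mean under every compatible measure. As it is
non-negative, Fatou's lemma bounds the integral of its limit inferior, hence `μ G`, by its initial
value. -/
theorem IsCompatible.measure_le_upperProb {φ : ForecastingSystem} {μ : ProbabilityMeasure Path}
    (hμ : IsCompatible φ (cylinderMass μ)) {G : Set Path} (hG : MeasurableSet G) :
    (μ : Measure Path).real G ≤ upperProb φ G := by
  refine le_csInf ⟨1, one_mem_upperProbValues φ G⟩ fun a ha => ?_
  have ha0 := upperProbValues_nonneg ha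
  obtain ⟨M, hM, h, rfl⟩ := ha
  have h0 : ∀ s, 0 ≤ M s := hM.le_of_le_liminf fun ω => le_trans
    (EReal.coe_le_coe_iff.2 (Set.indicator_nonneg (fun _ _ => zero_le_one) _)) (h ω)
  refine ENNReal.toReal_le_of_le_ofReal ha0 ?_
  calc (μ : Measure Path) G = ∫⁻ ω, G.indicator 1 ω ∂(μ : Measure Path) :=
        (lintegral_indicator_one hG).symm
    _ ≤ ∫⁻ ω, liminf (fun n => ENNReal.ofReal (M (initial ω n))) atTop ∂(μ : Measure Path) := by
        refine lintegral_mono fun ω => ?_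
        by_cases hω : ω ∈ G
        · have h1 := h ω
          rw [coe_le_liminf_coe_iff, Set.indicator_of_mem hω] at h1
          rw [Set.indicator_of_mem hω, Pi.one_apply, le_liminf_iff]
          intro y hy
          have hy' : y.toReal < 1 := by
            simpa using ENNReal.toReal_strict_mono ENNReal.one_ne_top hy
          filter_upwards [h1 (1 - y.toReal) (sub_pos.2 hy')] with n hn
          exact (ENNReal.lt_ofReal_iff_toReal_lt hy.ne_top).2 (by linarith)
        · simp [hω]
    _ ≤ liminf (fun n => ∫⁻ ω, ENNReal.ofReal (M (initial ω n)) ∂(μ : Measure Path)) atTop :=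
        lintegral_liminf_le fun n => measurable_comp_initial (fun s => ENNReal.ofReal (M s)) n
    _ ≤ ENNReal.ofReal (M []) := by
        refine liminf_le_of_frequently_le' (Frequently.of_forall fun n => ?_)
        have h1 := lintegral_supermartingale_le hμ hM h0 n []
        rwa [cylinder_nil, Measure.restrict_univ, List.length_nil, zero_add, hμ.1.1, one_mul] at h1

/-! ### Upper hitting probabilities -/

/-- The upper probability, conditional on a situation, of reaching `S` within a given number of
further steps (when `S` has not been reached yet). -/
noncomputable def hitValue (φ : ForecastingSystem) (S : Set Situation) : ℕ → Situation → ℝ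
  | 0, s => Set.indicator {s | ∃ t ∈ S, t <+: s} 1 s
  | k + 1, s => max (localExp (φ s).fst fun x => hitValue φ S k (s ++ [x]))
      (localExp (φ s).snd fun x => hitValue φ S k (s ++ [x]))

/-- The expectation is affine in `p`, so the endpoints are extremal. -/
theorem localExp_le_max {I : NonemptyInterval unitInterval} {p : unitInterval} (hp : p ∈ I)
    (f : Bool → ℝ) : localExp p f ≤ max (localExp I.fst f) (localExp I.snd f) := by
  have h1 : (I.fst : ℝ) ≤ p := hp.1
  have h2 : (p : ℝ) ≤ I.snd := hp.2
  simp only [localExp]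
  rcases le_total (f false) (f true) with h | h
  · exact le_max_of_le_right (by nlinarith)
  · exact le_max_of_le_left (by nlinarith)

theorem localExp_le_hitValue {φ : ForecastingSystem} (S : Set Situation) (k : ℕ) {s : Situation}
    {p : unitInterval} (hp : p ∈ φ s) :
    localExp p (fun x => hitValue φ S k (s ++ [x])) ≤ hitValue φ S (k + 1) s :=
  localExp_le_max hp _

theorem localExp_mono (p : unitInterval) {f g : Bool → ℝ} (h : ∀ x, f x ≤ g x) :
    localExp p f ≤ localExp p g :=
  add_le_add (mul_le_mul_of_nonneg_left (h _) p.2.1)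
    (mul_le_mul_of_nonneg_left (h _) (sub_nonneg.2 p.2.2))

theorem localExp_const (p : unitInterval) (c : ℝ) : localExp p (fun _ => c) = c := by
  rw [localExp]; ring

section HitValue

variable (φ : ForecastingSystem) (S : Set Situation)

theorem hitValue_le_one (k : ℕ) (s : Situation) : hitValue φ S k s ≤ 1 := by
  induction k generalizing s with
  | zero => exact Set.indicator_le_self' (fun _ _ => zero_le_one) _
  | succ k ih =>
    have h : ∀ p, localExp p (fun x => hitValue φ S k (s ++ [x])) ≤ 1 := fun p =>
      (localExp_mono p fun x => ih _).trans (localExp_const p 1).le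
    exact max_le (h _) (h _)

theorem hitValue_nonneg (k : ℕ) (s : Situation) : 0 ≤ hitValue φ S k s := by
  induction k generalizing s with
  | zero => exact Set.indicator_nonneg (fun _ _ => zero_le_one) _
  | succ k ih =>
    exact le_max_of_le_left ((localExp_const _ 0).ge.trans (localExp_mono _ fun x => ih _))

theorem hitValue_eq_one {S : Set Situation} {s t : Situation} (ht : t ∈ S) (hts : t <+: s)
    (k : ℕ) : hitValue φ S k s = 1 := by
  induction k generalizing s with
  | zero => exact Set.indicator_of_mem (s := {s | ∃ t ∈ S, t <+: s}) ⟨t, ht, hts⟩ _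
  | succ k ih =>
    simp only [hitValue, ih (hts.trans (List.prefix_append s _)), localExp_const, max_self]

theorem hitValue_le_succ (k : ℕ) (s : Situation) : hitValue φ S k s ≤ hitValue φ S (k + 1) s := by
  induction k generalizing s with
  | zero =>
    by_cases h : s ∈ {s | ∃ t ∈ S, t <+: s}
    · obtain ⟨t, ht, hts⟩ := h
      rw [hitValue_eq_one φ ht hts, hitValue_eq_one φ ht hts]
    · rw [hitValue, Set.indicator_of_notMem h]
      exact hitValue_nonneg φ S _ _
  | succ k ih => exact max_le_max (localExp_mono _ fun x => ih _) (localExp_mono _ fun x => ih _)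

theorem tendsto_hitValue (s : Situation) :
    Tendsto (fun k => hitValue φ S k s) atTop (nhds (⨆ k, hitValue φ S k s)) :=
  tendsto_atTop_ciSup (monotone_nat_of_le_succ fun k => hitValue_le_succ φ S k s)
    ⟨1, Set.forall_mem_range.2 fun k => hitValue_le_one φ S k s⟩

theorem hitValue_le_iSup (k : ℕ) (s : Situation) : hitValue φ S k s ≤ ⨆ k, hitValue φ S k s :=
  le_ciSup (f := fun k => hitValue φ S k s)
    ⟨1, Set.forall_mem_range.2 fun k => hitValue_le_one φ S k s⟩ k

theorem isSupermartingale_iSup_hitValue :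
    IsSupermartingale φ fun s => ⨆ k, hitValue φ S k s := by
  refine isSupermartingale_iff.2 fun s p hp => ?_
  refine le_of_tendsto (((tendsto_hitValue φ S _).const_mul _).add
    ((tendsto_hitValue φ S _).const_mul _)) (Eventually.of_forall fun k => ?_)
  exact (localExp_le_hitValue S k hp).trans (hitValue_le_iSup φ S (k + 1) s)

theorem initial_prefix (ω : Path) {m n : ℕ} (h : m ≤ n) : initial ω m <+: initial ω n := by
  induction n, h using Nat.le_induction with
  | base => exact List.prefix_rfl
  | succ n _ ih => exact initial_succ ω n ▸ ih.trans (List.prefix_append _ _)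

/-- The limiting hitting value is a supermartingale that is non-negative and equals one from the
moment `S` is reached. -/
theorem upperProb_cylinders_le : upperProb φ (cylinders S) ≤ ⨆ k, hitValue φ S k [] := by
  refine csInf_le (bddBelow_upperProbValues φ _)
    ⟨_, isSupermartingale_iSup_hitValue φ S, fun ω => coe_le_liminf_coe_iff.2 fun e he => ?_, rfl⟩
  by_cases hω : ω ∈ cylinders S
  · obtain ⟨n, hn⟩ := mem_cylinders.1 hω
    filter_upwards [eventually_ge_atTop n] with m hm
    rw [Set.indicator_of_mem hω]
    have h := hitValue_le_iSup φ S 0 (initial ω m)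
    rw [hitValue_eq_one φ hn (initial_prefix ω hm)] at h
    linarith
  · refine Eventually.of_forall fun m => ?_
    rw [Set.indicator_of_notMem hω]
    have h := (hitValue_nonneg φ S 0 _).trans (hitValue_le_iSup φ S 0 (initial ω m))
    linarith

/-- The hypothesis says that `μ` attains the maximum in the recursion for `hitValue` at each length
below the horizon `K`. The proof is backward induction from length `K`; only an inequality results,
since `S` may also be reached after stage `K`. -/
theorem hitValue_mul_cylinderMass_le (μ : ProbabilityMeasure Path) (K : ℕ)
    (h : ∀ k s, s.length + k + 1 = K → cylinderMass μ s * hitValue φ S (k + 1) s =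
      cylinderMass μ (s ++ [false]) * hitValue φ S k (s ++ [false]) +
        cylinderMass μ (s ++ [true]) * hitValue φ S k (s ++ [true]))
    (k : ℕ) (s : Situation) (hk : s.length + k = K) :
    cylinderMass μ s * hitValue φ S k s ≤ (μ : Measure Path).real (cylinder s ∩ cylinders S) := by
  induction k generalizing s with
  | zero =>
    by_cases hs : s ∈ {s | ∃ t ∈ S, t <+: s}
    · rw [hitValue, Set.indicator_of_mem hs, Pi.one_apply, mul_one, Set.inter_eq_left.2]
      · exact le_rfl
      · obtain ⟨t, ht, hts⟩ := hs
        intro ω hω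
        refine mem_cylinders.2 ⟨t.length, ?_⟩
        rw [mem_cylinder] at hω
        rw [List.prefix_iff_eq_take] at hts
        have h1 := List.prefix_iff_eq_take.1 (initial_prefix ω
          (show t.length ≤ s.length from hts ▸ (by simp)))
        rw [hω, length_initial, ← hts] at h1
        rwa [h1]
    · rw [hitValue, Set.indicator_of_notMem hs, mul_zero]
      exact measureReal_nonneg
  | succ k ih =>
    rw [h k s hk, cylinder_eq_union s, Set.union_inter_distrib_right, measureReal_union
      ((disjoint_cylinder s).mono Set.inter_subset_left Set.inter_subset_left)
      ((measurableSet_cylinder _).inter (isOpen_cylinders S).measurableSet)]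
    exact add_le_add (ih _ (by simp; omega)) (ih _ (by simp; omega))

end HitValue

/-! ### Measures generated by precise forecasting systems -/

/-- The mass function, conditional on a situation, given by the precise forecasts `p`. -/
def forecastMass (p : Situation → unitInterval) : Situation → Situation → ℝ
  | _, [] => 1
  | t, x :: s => (if x then (p t : ℝ) else 1 - p t) * forecastMass p (t ++ [x]) s

theorem forecastMass_append (p : Situation → unitInterval) (t s : Situation) (x : Bool) :
    forecastMass p t (s ++ [x]) =
      forecastMass p t s * if x then (p (t ++ s) : ℝ) else 1 - p (t ++ s) := by
  induction s generalizing t with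
  | nil => simp [forecastMass]
  | cons y s ih =>
    rw [List.cons_append, forecastMass, forecastMass, ih, mul_assoc]
    simp

theorem forecastMass_nonneg (p : Situation → unitInterval) (t s : Situation) :
    0 ≤ forecastMass p t s := by
  induction s generalizing t with
  | nil => exact zero_le_one
  | cons y s ih =>
    refine mul_nonneg ?_ (ih _)
    split_ifs
    · exact (p t).2.1
    · exact sub_nonneg.2 (p t).2.2

theorem exists_measure_of_forecasts (p : Situation → unitInterval) :
    ∃ μ : ProbabilityMeasure Path, ∀ s, cylinderMass μ (s ++ [true]) = p s * cylinderMass μ s := by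
  have hv : IsMassFunction (forecastMass p []) := by
    refine ⟨rfl, fun s => ⟨forecastMass_nonneg p _ _, ?_⟩⟩
    rw [forecastMass_append, forecastMass_append]
    simp
    ring
  obtain ⟨μ, hμ⟩ := hv.exists_measure
  refine ⟨μ, fun s => ?_⟩
  simp only [cylinderMass, hμ, forecastMass_append]
  simp [mul_comm]

/-- For each horizon `K`, a compatible measure that follows the maximising endpoints gives
`cylinders S` at least the hitting value at the root. This measure may depend on `K`, which is
harmless because `c` bounds all compatible measures. -/
theorem upperProb_cylinders_le_of_forall (φ : ForecastingSystem) (S : Set Situation) {c : ℝ}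
    (h : ∀ μ : ProbabilityMeasure Path, IsCompatible φ (cylinderMass μ) →
      (μ : Measure Path).real (cylinders S) ≤ c) : upperProb φ (cylinders S) ≤ c := by
  refine (upperProb_cylinders_le φ S).trans (ciSup_le fun K => ?_)
  -- The best endpoint depends on the number of steps left. Beyond the horizon the truncated
  -- subtraction gives `0`, and there the selection plays no role besides compatibility.
  have hp : ∀ s, ∃ p ∈ φ s, localExp p (fun x => hitValue φ S (K - s.length - 1) (s ++ [x])) =
      hitValue φ S (K - s.length - 1 + 1) s := by
    intro s
    rcases max_choice (localExp (φ s).fst fun x => hitValue φ S (K - s.length - 1) (s ++ [x]))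
      (localExp (φ s).snd fun x => hitValue φ S (K - s.length - 1) (s ++ [x])) with h | h
    · exact ⟨_, ⟨le_rfl, (φ s).fst_le_snd⟩, h.symm⟩
    · exact ⟨_, ⟨(φ s).fst_le_snd, le_rfl⟩, h.symm⟩
  choose p hp hpW using hp
  obtain ⟨μ, hμ⟩ := exists_measure_of_forecasts p
  have hm : IsMassFunction (cylinderMass μ) := isMassFunction_measure μ
  have hc : IsCompatible φ (cylinderMass μ) := ⟨hm, fun s => by
    rw [hμ]
    exact ⟨mul_le_mul_of_nonneg_right (hp s).1 (hm.2 s).1,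
      mul_le_mul_of_nonneg_right (hp s).2 (hm.2 s).1⟩⟩
  refine le_trans ?_ (h μ hc)
  have h1 := hitValue_mul_cylinderMass_le φ S μ K (fun k s hk => ?_) K [] (by simp)
  · rwa [hm.1, one_mul, cylinder_nil, Set.univ_inter] at h1
  · have h2 := hpW s
    rw [show K - s.length - 1 = k by omega, localExp] at h2
    have h3 := (hm.2 s).2
    rw [hμ] at h3 ⊢
    rw [← h2]
    linear_combination (hitValue φ S k (s ++ [false])) * h3

/-- Outer regularity reduces to open sets. For precise forecasts both terms of the maximum in
`hitValue` coincide, so `μ` itself attains it at every horizon. -/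
theorem IsCompatible.upperProb_le {φ : ForecastingSystem} {μ : ProbabilityMeasure Path} (hφ : φ.IsPrecise)
    (hμ : IsCompatible φ (cylinderMass μ)) (G : Set Path) :
    upperProb φ G ≤ (μ : Measure Path).real G := by
  refine le_of_forall_pos_le_add fun e he => ?_
  obtain ⟨U, hGU, hU, hμU⟩ := Set.exists_isOpen_le_add G (μ : Measure Path)
    (ENNReal.ofReal_pos.2 he).ne'
  obtain ⟨S, rfl⟩ := exists_cylinders_eq hU
  have h1 : upperProb φ (cylinders S) ≤ (μ : Measure Path).real (cylinders S) := by
    refine (upperProb_cylinders_le φ S).trans (ciSup_le fun K => ?_)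
    have h1 := hitValue_mul_cylinderMass_le φ S μ K (fun k s hk => ?_) K [] (by simp)
    · rwa [hμ.1.1, one_mul, cylinder_nil, Set.univ_inter] at h1
    · obtain ⟨h2, h3⟩ := hμ.2 s
      rw [hitValue, ← hφ s, max_self, localExp]
      rw [← hφ s] at h3
      have h4 := le_antisymm h3 h2
      have h5 := (hμ.1.2 s).2
      rw [h4] at h5 ⊢
      linear_combination (hitValue φ S k (s ++ [false])) * h5
  refine (upperProb_mono_right φ hGU).trans (h1.trans ?_)
  have h2 := ENNReal.toReal_mono (by finiteness) hμU
  rwa [ENNReal.toReal_add (by finiteness) (by finiteness), ENNReal.toReal_ofReal he.le] at h2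

theorem IsCompatible.generates {φ : ForecastingSystem} {μ : ProbabilityMeasure Path} (hφ : φ.IsPrecise)
    (hμ : IsCompatible φ (cylinderMass μ)) : Generates φ μ := by
  have h : ∀ G : Set Path, MeasurableSet G → upperProb φ G = (μ : Measure Path).real G :=
    fun G hG => le_antisymm (hμ.upperProb_le hφ G) (hμ.measure_le_upperProb hG)
  refine fun G hG => ⟨?_, h G hG⟩
  rw [lowerProb_eq, h _ hG.compl, probReal_compl_eq_one_sub hG, sub_sub_cancel]

/-- Given a generating `ψ`, the measure `ν` built from its forecasts is also generated by `ψ`, so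
both have the same cylinder masses. Conversely, forecasts selected from the conditional
probabilities of `μ` generate `μ`. -/
theorem mem_compatibleMeasures_iff {φ : ForecastingSystem} {μ : ProbabilityMeasure Path} :
    μ ∈ compatibleMeasures φ ↔ IsCompatible φ (cylinderMass μ) := by
  have hm : ∀ ν, IsMassFunction (cylinderMass ν) := fun ν => isMassFunction_measure ν
  constructor
  · rintro ⟨ψ, hψ, hle, hgen⟩
    obtain ⟨ν, hν⟩ := exists_measure_of_forecasts fun s => (ψ s).fst
    have hc : IsCompatible ψ (cylinderMass ν) :=
      ⟨hm ν, fun s => ⟨(hν s).ge, by rw [← hψ s]; exact (hν s).le⟩⟩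
    have h : cylinderMass μ = cylinderMass ν := funext fun s =>
      (hgen _ (measurableSet_cylinder s)).2.symm.trans
        (hc.generates hψ _ (measurableSet_cylinder s)).2
    exact h ▸ hc.mono hle
  · intro h
    choose p hp hμp using h.exists_forecast
    refine ⟨fun s => NonemptyInterval.pure (p s), fun s => rfl, fun s => ⟨(hp s).1, (hp s).2⟩, ?_⟩
    refine IsCompatible.generates (fun s => rfl) ⟨hm μ, fun s => ⟨(hμp s).ge, (hμp s).le⟩⟩

/-! ### Compactness of the class of compatible measures -/

theorem mem_basicOpen {b : Generator} {μ : ProbabilityMeasure Path} :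
    μ ∈ basicOpen b ↔ ∀ c ∈ b, (c.1 : ℝ) < cylinderMass μ c.2.1 ∧ cylinderMass μ c.2.1 < c.2.2 :=
  Iff.rfl

theorem IsMassFunction.le_one {v : Situation → ℝ} (hv : IsMassFunction v) (s : Situation) :
    v s ≤ 1 := by
  obtain ⟨μ, hμ⟩ := hv.exists_measure
  exact hμ s ▸ measureReal_le_one

/-- Every measure is compatible with the vacuous forecasts `[0,1]`, hence generated by some precise
`ψ`. A measure with the same cylinder masses is compatible with `ψ` too, and both agree with
`upperProb ψ` on Borel sets. -/
theorem cylinderMass_injective : Function.Injective cylinderMass := by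
  intro μ ν h
  have hm : IsMassFunction (cylinderMass μ) := isMassFunction_measure μ
  have hμ : IsCompatible (fun _ => ⟨(0, 1), zero_le_one⟩) (cylinderMass μ) := by
    refine ⟨hm, fun s => ⟨?_, ?_⟩⟩
    · simpa using (hm.2 _).1
    · simpa [(hm.2 s).2] using (hm.2 _).1
  obtain ⟨ψ, hψ, -, hgen⟩ := mem_compatibleMeasures_iff.2 hμ
  have hψμ : IsCompatible ψ (cylinderMass μ) :=
    mem_compatibleMeasures_iff.1 ⟨ψ, hψ, le_rfl, hgen⟩
  suffices h' : (μ : Measure Path) = ν from Subtype.ext h'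
  refine Measure.ext fun G hG => ?_
  rw [← ENNReal.toReal_eq_toReal_iff' (measure_ne_top (μ : Measure Path) G)
    (measure_ne_top (ν : Measure Path) G)]
  exact (hgen G hG).2.symm.trans ((h ▸ hψμ).generates hψ G hG).2

theorem isClosed_isCompatible (φ : ForecastingSystem) : IsClosed {v | IsCompatible φ v} := by
  have h : {v | IsCompatible φ v} = {v : Situation → ℝ | v [] = 1} ∩ ⋂ s,
      ({v | 0 ≤ v s} ∩ {v | v s = v (s ++ [false]) + v (s ++ [true])} ∩
        {v | ((φ s).fst : ℝ) * v s ≤ v (s ++ [true])} ∩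
        {v | v (s ++ [true]) ≤ ((φ s).snd : ℝ) * v s}) := by
    ext v
    simp only [IsCompatible, IsMassFunction, Set.mem_ofPred_eq, Set.mem_inter_iff, Set.mem_iInter]
    grind
  rw [h]
  have hc : ∀ s, Continuous fun v : Situation → ℝ => v s := continuous_apply
  refine (isClosed_eq (hc _) continuous_const).inter (isClosed_iInter fun s =>
    (((isClosed_le continuous_const (hc _)).inter (isClosed_eq (hc _) ((hc _).add (hc _)))).inter
      (isClosed_le ((hc _).const_mul _) (hc _))).inter (isClosed_le (hc _) ((hc _).const_mul _)))

theorem isCompact_isCompatible (φ : ForecastingSystem) : IsCompact {v | IsCompatible φ v} := by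
  refine (isCompact_univ_pi fun _ : Situation => isCompact_Icc (a := (0 : ℝ)) (b := 1)).of_isClosed_subset
    (isClosed_isCompatible φ) fun v hv s _ => ⟨(hv.1.2 s).1, hv.1.le_one s⟩

/-- The class is the image of the compact set of compatible mass functions. The map from mass
functions to measures is continuous because a basic open set constrains only finitely many
coordinates. -/
theorem isCompact_compatibleMeasures (φ : ForecastingSystem) :
    @IsCompact _ measureTopology (compatibleMeasures φ) := by
  choose m hm using fun v : {v | IsCompatible φ v} => v.2.1.exists_measure
  have hmass : ∀ v, cylinderMass (m v) = v := fun v => funext (hm v)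
  have hcont : @Continuous _ _ _ measureTopology m := by
    refine continuous_generateFrom_iff.2 ?_
    rintro _ ⟨b, rfl⟩
    have h : m ⁻¹' basicOpen b = ⋂ c ∈ b, {v | (c.1 : ℝ) < v.1 c.2.1 ∧ v.1 c.2.1 < (c.2.2 : ℝ)} := by
      ext v
      simp only [Set.mem_preimage, mem_basicOpen, hmass, Set.mem_iInter]
      rfl
    rw [h]
    refine isOpen_biInter_finset fun c _ => ?_
    have hc : Continuous fun v : {v | IsCompatible φ v} => v.1 c.2.1 :=
      (continuous_apply _).comp continuous_subtype_val
    exact (isOpen_lt continuous_const hc).inter (isOpen_lt hc continuous_const)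
  have : CompactSpace {v | IsCompatible φ v} := isCompact_iff_compactSpace.1 (isCompact_isCompatible φ)
  have himg : compatibleMeasures φ = Set.range m := by
    ext μ
    rw [mem_compatibleMeasures_iff]
    constructor
    · exact fun h => ⟨⟨_, h⟩, cylinderMass_injective (hmass _)⟩
    · rintro ⟨v, rfl⟩
      exact (hmass v).symm ▸ v.2
  rw [himg]
  exact @isCompact_range _ _ _ measureTopology _ _ hcont

/-! ### Computability -/

section Computability

variable {α : Type*} [Primcodable α]

theorem rePred_exists_of_computable {f : α → ℕ → Bool} (hf : Computable₂ f) :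
    REPred fun a => ∃ n, f a n = true := by
  refine (Partrec.rfind (p := fun a n => Part.some (f a n)) hf.partrec₂).dom_re.of_eq fun a => ?_
  refine Nat.rfind_dom.trans (exists_congr fun n => ?_)
  simp only [Part.mem_some_iff, Part.some_dom, implies_true, and_true, eq_comm]

/-- The number `n` bounds the evaluation of a code for the partial recursive function with domain
`p`. -/
theorem exists_computable_of_rePred {p : α → Prop} (hp : REPred p) :
    ∃ f : α → ℕ → Bool, Computable₂ f ∧ ∀ a, p a ↔ ∃ n, f a n = true := by
  obtain ⟨c, hc⟩ := Nat.Partrec.Code.exists_code.1 hp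
  refine ⟨fun a n => (Nat.Partrec.Code.evaln n c (Encodable.encode a)).isSome, ?_, fun a => ?_⟩
  · exact (Primrec.option_isSome.comp (Nat.Partrec.Code.primrec_evaln.comp
      ((Primrec.snd.pair (Primrec.const c)).pair
        (Primrec.encode.comp Primrec.fst)))).to_comp
  · have h : p a ↔ (c.eval (Encodable.encode a)).Dom := by
      rw [hc]
      simp [Part.assert]
    rw [h, Part.dom_iff_mem]
    simp only [Nat.Partrec.Code.evaln_complete, Option.isSome_iff_exists]
    exact exists_comm

theorem computable_forall_lt {f : α → ℕ → Bool} (hf : Computable₂ f) :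
    Computable₂ fun a n => decide (∀ i < n, f a i = true) := by
  have h : Computable fun p : α × ℕ =>
      (Nat.rec true (fun k ih => ih && f p.1 k) p.2 : Bool) := by
    refine Computable.nat_rec (f := fun p : α × ℕ => p.2) (g := fun _ => true)
      (h := fun p q => q.2 && f p.1 q.1) Computable.snd (Computable.const true) ?_
    exact Primrec.and.to_comp.comp (Computable.snd.comp Computable.snd)
      (hf.comp (Computable.fst.comp Computable.fst) (Computable.fst.comp Computable.snd))
  refine h.of_eq fun p => ?_
  obtain ⟨a, n⟩ := p
  induction n with
  | zero => simp
  | succ n ih =>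
    simp only at ih ⊢
    rw [ih, Bool.eq_iff_iff]
    simp only [Bool.and_eq_true, decide_eq_true_eq, Nat.forall_lt_succ_right]

/-! ### Primitive recursive arithmetic on integers and rationals. -/

theorem primrec_natAbs : Primrec Int.natAbs := by
  -- Integers are encoded by `n ↦ 2 * n` and `-(n + 1) ↦ 2 * n + 1`.
  have h : Primrec fun z : ℤ => (Encodable.encode z + 1) / 2 :=
    Primrec.nat_div.comp (Primrec.succ.comp Primrec.encode) (Primrec.const 2)
  refine h.of_eq fun z => ?_
  cases z with
  | ofNat n => change (2 * n + 1) / 2 = n; omega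
  | negSucc n => change (2 * n + 1 + 1) / 2 = n + 1; omega

theorem primrecPred_int_nonneg : PrimrecPred fun z : ℤ => 0 ≤ z := by
  have h : PrimrecPred fun z : ℤ => Encodable.encode z % 2 = 0 :=
    Primrec.eq.comp (Primrec.nat_mod.comp Primrec.encode (Primrec.const 2)) (Primrec.const 0)
  refine h.of_eq fun z => ?_
  cases z with
  | ofNat n => change (2 * n) % 2 = 0 ↔ _; simp
  | negSucc n => change (2 * n + 1) % 2 = 0 ↔ _; omega

theorem primrec_rat_num_den : Primrec fun q : ℚ => (q.num, q.den) := by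
  let : Primcodable {p : ℤ × ℕ // 0 < p.2 ∧ p.1.natAbs.Coprime p.2} :=
    Primcodable.subtype primrecPred_reduced
  exact (Primrec.subtype_val (hp := primrecPred_reduced)).comp
    (Primrec.of_equiv (e := ratEquivReduced))

theorem primrec_natCast_rat : Primrec fun n : ℕ => (n : ℚ) := by
  let : Primcodable {p : ℤ × ℕ // 0 < p.2 ∧ p.1.natAbs.Coprime p.2} :=
    Primcodable.subtype primrecPred_reduced
  have h : Primrec fun n : ℕ => (n : ℤ) := by
    refine Primrec.encode_iff.1 ?_
    exact (Primrec.nat_mul.comp (Primrec.const 2) Primrec.id).of_eq fun n => rfl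
  refine (Primrec.of_equiv_iff ratEquivReduced).1 ?_
  refine (Primrec.subtype_val_iff (hp := primrecPred_reduced)).1 ?_
  exact (h.pair (Primrec.const 1)).of_eq fun n => by simp [ratEquivReduced]

/-- Comparison of a natural number with a rational multiple of another one. -/
theorem primrecPred_natCast_le_mul :
    PrimrecPred fun p : ℚ × ℕ × ℕ => (p.2.1 : ℚ) ≤ p.1 * p.2.2 := by
  have hnd : Primrec fun p : ℚ × ℕ × ℕ => (p.1.num, p.1.den) :=
    primrec_rat_num_den.comp Primrec.fst
  have hnum : Primrec fun p : ℚ × ℕ × ℕ => p.1.num := Primrec.fst.comp hnd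
  have hden : Primrec fun p : ℚ × ℕ × ℕ => p.1.den := Primrec.snd.comp hnd
  have habs : Primrec fun p : ℚ × ℕ × ℕ => p.1.num.natAbs := primrec_natAbs.comp hnum
  have ha : Primrec fun p : ℚ × ℕ × ℕ => p.2.1 := Primrec.fst.comp Primrec.snd
  have hb : Primrec fun p : ℚ × ℕ × ℕ => p.2.2 := Primrec.snd.comp Primrec.snd
  have had : Primrec fun p : ℚ × ℕ × ℕ => p.2.1 * p.1.den := Primrec.nat_mul.comp ha hden
  have hab : Primrec fun p : ℚ × ℕ × ℕ => p.1.num.natAbs * p.2.2 := Primrec.nat_mul.comp habs hb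
  have hpos : PrimrecPred fun p : ℚ × ℕ × ℕ => 0 ≤ p.1.num := primrecPred_int_nonneg.comp hnum
  -- Clearing the denominator leaves natural numbers. With a negative numerator the inequality holds
  -- only if both products vanish.
  refine ((hpos.and (Primrec.nat_le.comp had hab)).or (hpos.not.and
    (Primrec.eq.comp (Primrec.nat_add.comp had hab) (Primrec.const 0)))).of_eq fun p => ?_
  obtain ⟨q, a, b⟩ := p
  have hd : (0 : ℚ) < q.den := by exact_mod_cast q.den_pos
  have h : (a : ℚ) ≤ q * b ↔ (a : ℤ) * q.den ≤ q.num * b := by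
    nth_rewrite 1 [← Rat.num_div_den q]
    rw [div_mul_eq_mul_div, le_div_iff₀ hd]
    exact_mod_cast Iff.rfl
  simp only [h]
  zify
  rcases le_or_gt 0 q.num with h0 | h0
  · simp [h0, abs_of_nonneg h0]
  · simp only [h0.not_ge, false_and, not_false_eq_true, true_and, false_or, abs_of_neg h0]
    have h1 : 0 ≤ (a : ℤ) * q.den := by positivity
    have h2 : 0 ≤ -q.num * (b : ℤ) := mul_nonneg (by omega) (by positivity)
    constructor <;> intro h3 <;> linarith

/-- Sign test for an affine expression with natural and rational coefficients. -/
theorem primrecPred_natCast_add_mul_pos :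
    PrimrecPred fun p : ℚ × ℕ × ℕ => 0 < (p.2.1 : ℚ) + p.1 * p.2.2 := by
  have hnd : Primrec fun p : ℚ × ℕ × ℕ => (p.1.num, p.1.den) :=
    primrec_rat_num_den.comp Primrec.fst
  have hnum : Primrec fun p : ℚ × ℕ × ℕ => p.1.num := Primrec.fst.comp hnd
  have hden : Primrec fun p : ℚ × ℕ × ℕ => p.1.den := Primrec.snd.comp hnd
  have habs : Primrec fun p : ℚ × ℕ × ℕ => p.1.num.natAbs := primrec_natAbs.comp hnum
  have ha : Primrec fun p : ℚ × ℕ × ℕ => p.2.1 := Primrec.fst.comp Primrec.snd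
  have hb : Primrec fun p : ℚ × ℕ × ℕ => p.2.2 := Primrec.snd.comp Primrec.snd
  have had : Primrec fun p : ℚ × ℕ × ℕ => p.2.1 * p.1.den := Primrec.nat_mul.comp ha hden
  have hab : Primrec fun p : ℚ × ℕ × ℕ => p.1.num.natAbs * p.2.2 := Primrec.nat_mul.comp habs hb
  have hpos : PrimrecPred fun p : ℚ × ℕ × ℕ => 0 ≤ p.1.num := primrecPred_int_nonneg.comp hnum
  refine ((hpos.and (Primrec.nat_lt.comp (Primrec.const 0) (Primrec.nat_add.comp had hab))).or
    (hpos.not.and (Primrec.nat_lt.comp hab had))).of_eq fun p => ?_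
  obtain ⟨q, a, b⟩ := p
  have hd : (0 : ℚ) < q.den := by exact_mod_cast q.den_pos
  have h : 0 < (a : ℚ) + q * b ↔ 0 < (a : ℤ) * q.den + q.num * b := by
    nth_rewrite 1 [← Rat.num_div_den q]
    rw [div_mul_eq_mul_div, ← sub_neg_eq_add, sub_pos, ← neg_div, div_lt_iff₀ hd,
      neg_lt_iff_pos_add]
    exact_mod_cast Iff.rfl
  simp only [h]
  zify
  rcases le_or_gt 0 q.num with h0 | h0
  · simp [h0, abs_of_nonneg h0]
  · simp only [h0.not_ge, false_and, not_false_eq_true, true_and, false_or, abs_of_neg h0]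
    constructor <;> intro h3 <;> linarith

end Computability

/-! ### A finitary criterion for covers by basic open sets -/

open Encodable

/-- The digit in base `N + 1` of `c` that belongs to `s`: an approximation, with denominator `N`,
of the mass of `s`. -/
def gridDigit (N c : ℕ) (s : Situation) : ℕ := c / (N + 1) ^ encode s % (N + 1)

/-- The masses on the grid with denominator `N` that are encoded by `c` are far from satisfying the
constraints at `s` that are imposed by approximations `a` and `b` of the lower forecast and the
negated upper forecast. -/
def GridViolates (a b : ℚ) (N c : ℕ) (s : Situation) : Prop :=
  (encode s < N ∧ encode (s ++ [false]) < N ∧ encode (s ++ [true]) < N) ∧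
    (s.length = 0 ∧ gridDigit N c s ≠ N ∨
      gridDigit N c (s ++ [false]) + gridDigit N c (s ++ [true]) + 1 < gridDigit N c s ∨
      gridDigit N c s < gridDigit N c (s ++ [false]) + gridDigit N c (s ++ [true]) ∨
      ((gridDigit N c (s ++ [true]) + 1 : ℕ) : ℚ) ≤ a * (gridDigit N c s : ℕ) ∨
      0 < (gridDigit N c (s ++ [true]) : ℚ) + b * (gridDigit N c s + 1 : ℕ))

/-- The mass of a situation lies well inside a given interval. -/
def GridInside (N c : ℕ) (t : ℚ × Situation × ℚ) : Prop :=
  encode t.2.1 < N ∧ ¬((gridDigit N c t.2.1 : ℚ) ≤ t.1 * N) ∧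
    ((gridDigit N c t.2.1 + 1 : ℕ) : ℚ) ≤ t.2.2 * N

theorem gridDigit_le (N c : ℕ) (s : Situation) : gridDigit N c s ≤ N :=
  Nat.le_of_lt_succ (Nat.mod_lt _ N.succ_pos)

/-- A single number below `(N + 1) ^ N` encodes all digits for the situations with code below `N`,
so quantification over grid points becomes bounded. -/
theorem exists_gridDigit_eq (N : ℕ) (f : Situation → ℕ) (hf : ∀ s, f s ≤ N) :
    ∃ c < (N + 1) ^ N, ∀ s, encode s < N → gridDigit N c s = f s := by
  let g : Fin N → Fin (N + 1) := fun i =>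
    ⟨f ((decode (α := Situation) i).getD []), Nat.lt_succ_of_le (hf _)⟩
  refine ⟨finFunctionFinEquiv g, (finFunctionFinEquiv g).2, fun s hs => ?_⟩
  have h : ((finFunctionFinEquiv.symm (finFunctionFinEquiv g)) ⟨encode s, hs⟩ : ℕ) = f s := by
    rw [Equiv.symm_apply_apply]
    simp [g]
  exact h

section GridCriterion

variable {φ : ForecastingSystem} {q r : Situation × ℕ → ℚ}

/-- Soundness of the grid test. The masses are rounded down, so a digit `d` stands for a mass in `[d
/ N, (d + 1) / N)`. The margins of one in `GridViolates` and `GridInside` absorb the rounding, and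
`q`, `r` describe intervals that contain those of `φ`, hence weaker constraints. -/
theorem IsCompatible.exists_grid {v : Situation → ℝ} (hv : IsCompatible φ v)
    (hq : ∀ s n, (q (s, n) : ℝ) ≤ (φ s).fst) (hr : ∀ s n, (r (s, n) : ℝ) ≤ -((φ s).snd : ℝ))
    (N : ℕ) : ∃ c < (N + 1) ^ N, (∀ s, ¬GridViolates (q (s, N)) (r (s, N)) N c s) ∧
      ∀ t, GridInside N c t → (t.1 : ℝ) < v t.2.1 ∧ v t.2.1 < t.2.2 := by
  have hN : (0 : ℝ) ≤ N := N.cast_nonneg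
  have hpos : ∀ s, 0 ≤ N * v s := fun s => mul_nonneg hN (hv.1.2 s).1
  obtain ⟨c, hc, hd⟩ := exists_gridDigit_eq N (fun s => ⌊N * v s⌋₊) fun s => by
    refine Nat.floor_le_of_le ?_
    simpa using mul_le_mul_of_nonneg_left (hv.1.le_one s) hN
  have hle : ∀ s, encode s < N → (gridDigit N c s : ℝ) ≤ N * v s := fun s hs =>
    hd s hs ▸ Nat.floor_le (hpos s)
  have hlt : ∀ s, encode s < N → N * v s < gridDigit N c s + 1 := fun s hs =>
    hd s hs ▸ Nat.lt_floor_add_one _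
  refine ⟨c, hc, fun s => ?_, fun t => ?_⟩
  · rintro ⟨⟨hs, hs0, hs1⟩, h⟩
    have hsum : N * v s = N * v (s ++ [false]) + N * v (s ++ [true]) := by
      rw [(hv.1.2 s).2, mul_add]
    rcases h with ⟨h, h'⟩ | h | h | h | h
    · rw [hd s hs, List.length_eq_zero_iff.1 h, hv.1.1] at h'
      simp at h'
    · have h' : (gridDigit N c (s ++ [false]) : ℝ) + gridDigit N c (s ++ [true]) + 1 + 1 ≤
        gridDigit N c s := by exact_mod_cast h
      linarith [hle s hs, hlt _ hs0, hlt _ hs1]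
    · have h' : (gridDigit N c s : ℝ) + 1 ≤ gridDigit N c (s ++ [false]) +
        gridDigit N c (s ++ [true]) := by exact_mod_cast h
      linarith [hlt s hs, hle _ hs0, hle _ hs1]
    · have h' : (gridDigit N c (s ++ [true]) : ℝ) + 1 ≤ q (s, N) * gridDigit N c s := by
        exact_mod_cast h
      have h1 := mul_le_mul_of_nonneg_left (hv.2 s).1 hN
      have h2 := mul_le_mul_of_nonneg_right (hq s N) (Nat.cast_nonneg (α := ℝ) (gridDigit N c s))
      have h3 := mul_le_mul_of_nonneg_left (hle s hs) (φ s).fst.2.1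
      linarith [hlt _ hs1]
    · have h' : (0 : ℝ) < gridDigit N c (s ++ [true]) + r (s, N) * (gridDigit N c s + 1) := by
        exact_mod_cast h
      have h1 := mul_le_mul_of_nonneg_left (hv.2 s).2 hN
      have h2 := mul_le_mul_of_nonneg_right (hr s N)
        (Nat.cast_nonneg (α := ℝ) (gridDigit N c s + 1))
      have h3 := mul_le_mul_of_nonneg_left (hlt s hs).le (φ s).snd.2.1
      push_cast at h2
      linarith [hle _ hs1]
  · rintro ⟨hs, h1, h2⟩
    have h1' : (t.1 : ℝ) * N < gridDigit N c t.2.1 := by exact_mod_cast not_le.1 h1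
    have h2' : (gridDigit N c t.2.1 : ℝ) + 1 ≤ t.2.2 * N := by exact_mod_cast h2
    have hN' : (0 : ℝ) < N := by exact_mod_cast (Nat.zero_le _).trans_lt hs
    constructor
    · refine lt_of_mul_lt_mul_right ?_ hN
      linarith [hle _ hs]
    · refine lt_of_mul_lt_mul_right ?_ hN
      linarith [hlt _ hs]

/-- The criterion: all points on some grid violate a constraint or lie inside a basic open set. -/
def GridCovers (q r : Situation × ℕ → ℚ) (L : List (List (ℚ × Situation × ℚ))) (N : ℕ) : Prop :=
  ∀ c < (N + 1) ^ N, (∃ s, GridViolates (q (s, N)) (r (s, N)) N c s) ∨ ∃ b ∈ L, ∀ t ∈ b, GridInside N c t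

/-- Completeness of the grid test. An ultrafilter finer than `atTop` makes the rescaled digits
converge at all situations at once. Each non-violated constraint holds up to errors that vanish with
`1 / N`, hence exactly in the limit, while strict inequalities in the limit give back `GridInside`
for most `N`. -/
theorem exists_isCompatible_of_forall_grid
    (hq : ∀ s, Tendsto (fun n => (q (s, n) : ℝ)) atTop (nhds (φ s).fst))
    (hr : ∀ s, Tendsto (fun n => (r (s, n) : ℝ)) atTop (nhds (-((φ s).snd : ℝ))))
    (c : ℕ → ℕ) (hc : ∀ N s, ¬GridViolates (q (s, N)) (r (s, N)) N (c N) s) :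
    ∃ v, IsCompatible φ v ∧
      ∀ t : ℚ × Situation × ℚ, (t.1 : ℝ) < v t.2.1 → v t.2.1 < t.2.2 →
        ∀ᶠ N in hyperfilter ℕ, GridInside N (c N) t := by
  let f : ℕ → Situation → ℝ := fun N s => gridDigit N (c N) s / N
  have hU : (hyperfilter ℕ : Filter ℕ) ≤ atTop := Nat.hyperfilter_le_atTop
  have hf : ∀ N s, f N s ∈ Set.Icc (0 : ℝ) 1 := fun N s =>
    ⟨by positivity, div_le_one_of_le₀ (by exact_mod_cast gridDigit_le N (c N) s) N.cast_nonneg⟩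
  have hlim : ∀ s, ∃ a : ℝ, Tendsto (fun N => f N s) (hyperfilter ℕ) (nhds a) := by
    intro s
    obtain ⟨a, -, ha⟩ := isCompact_Icc.ultrafilter_le_nhds' ((hyperfilter ℕ).map fun N => f N s)
      (Filter.mem_map.2 (univ_mem' fun N => hf N s))
    exact ⟨a, ha⟩
  choose v hv using hlim
  have hinv : Tendsto (fun N : ℕ => 1 / (N : ℝ)) (hyperfilter ℕ) (nhds 0) :=
    tendsto_one_div_atTop_nhds_zero_nat.mono_left hU
  have hlarge : ∀ k : ℕ, ∀ᶠ N in (hyperfilter ℕ : Filter ℕ), k < N := fun k =>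
    hU (eventually_gt_atTop k)
  have hdig : ∀ N s, 0 < N → (gridDigit N (c N) s : ℝ) = f N s * N := fun N s h => by
    have : (N : ℝ) ≠ 0 := by exact_mod_cast h.ne'
    simp only [f]
    field_simp
  have hev : ∀ s, ∀ᶠ N in (hyperfilter ℕ : Filter ℕ), 0 < N ∧ (s.length = 0 → f N s = 1) ∧
      f N s ≤ f N (s ++ [false]) + f N (s ++ [true]) + 1 / N ∧
      f N (s ++ [false]) + f N (s ++ [true]) ≤ f N s ∧
      q (s, N) * f N s ≤ f N (s ++ [true]) + 1 / N ∧
      f N (s ++ [true]) + r (s, N) * (f N s + 1 / N) ≤ 0 := by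
    intro s
    filter_upwards [hlarge (encode s), hlarge (encode (s ++ [false])),
      hlarge (encode (s ++ [true]))] with N hs hs0 hs1
    have h := hc N s
    simp only [GridViolates, hs, hs0, hs1, and_self, true_and, not_or, not_and, not_not, not_lt,
      not_le] at h
    obtain ⟨h1, h2, h3, h4, h5⟩ := h
    have hN : 0 < N := (Nat.zero_le _).trans_lt hs
    have hN' : (0 : ℝ) < N := by exact_mod_cast hN
    have h2' : (gridDigit N (c N) s : ℝ) ≤ gridDigit N (c N) (s ++ [false]) +
      gridDigit N (c N) (s ++ [true]) + 1 := by exact_mod_cast h2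
    have h3' : (gridDigit N (c N) (s ++ [false]) : ℝ) + gridDigit N (c N) (s ++ [true]) ≤
      gridDigit N (c N) s := by exact_mod_cast h3
    have h4' : (q (s, N) : ℝ) * gridDigit N (c N) s ≤ gridDigit N (c N) (s ++ [true]) + 1 := by
      exact_mod_cast h4.le
    have h5' : (gridDigit N (c N) (s ++ [true]) : ℝ) + r (s, N) * (gridDigit N (c N) s + 1) ≤ 0 := by
      exact_mod_cast h5
    have hone : 1 / (N : ℝ) * N = 1 := one_div_mul_cancel hN'.ne'
    simp only [hdig N _ hN] at h2' h3' h4' h5'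
    refine ⟨hN, fun h => ?_, ?_, ?_, ?_, ?_⟩
    · simp only [f, h1 h]
      exact div_self hN'.ne'
    · refine le_of_mul_le_mul_right ?_ hN'
      linarith
    · refine le_of_mul_le_mul_right ?_ hN'
      linarith
    · refine le_of_mul_le_mul_right ?_ hN'
      linarith
    · refine le_of_mul_le_mul_right ?_ hN'
      linear_combination h5' + (r (s, N) : ℝ) * hone
  refine ⟨v, ⟨⟨?_, fun s => ⟨?_, le_antisymm ?_ ?_⟩⟩, fun s => ⟨?_, ?_⟩⟩, fun t h1 h2 => ?_⟩
  · refine tendsto_nhds_unique (hv []) (tendsto_const_nhds.congr' ?_)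
    filter_upwards [hev []] with N h using (h.2.1 rfl).symm
  · exact ge_of_tendsto' (hv s) fun N => (hf N s).1
  · refine le_of_tendsto_of_tendsto (hv s) (g := fun N => f N (s ++ [false]) + f N (s ++ [true]) + 1 / N) ?_ ?_
    · simpa using ((hv (s ++ [false])).add (hv (s ++ [true]))).add hinv
    · filter_upwards [hev s] with N h using h.2.2.1
  · refine le_of_tendsto_of_tendsto ((hv (s ++ [false])).add (hv (s ++ [true]))) (hv s) ?_
    filter_upwards [hev s] with N h using h.2.2.2.1
  · refine le_of_tendsto_of_tendsto (((hq s).mono_left hU).mul (hv s))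
      (g := fun N => f N (s ++ [true]) + 1 / N) ?_ ?_
    · simpa using (hv (s ++ [true])).add hinv
    · filter_upwards [hev s] with N h using h.2.2.2.2.1
  · have h := le_of_tendsto ((hv (s ++ [true])).add
      (((hr s).mono_left hU).mul ((hv s).add hinv))) ((hev s).mono fun N h => h.2.2.2.2.2)
    rw [add_zero] at h
    linarith
  · have h3 : Tendsto (fun N => f N t.2.1 + 1 / N) (hyperfilter ℕ) (nhds (v t.2.1)) := by
      simpa using (hv t.2.1).add hinv
    filter_upwards [hlarge (encode t.2.1), (hv t.2.1).eventually_const_lt h1,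
      h3.eventually_lt_const h2] with N hs h1 h2
    have hN : 0 < N := (Nat.zero_le _).trans_lt hs
    have hN' : (0 : ℝ) < N := by exact_mod_cast hN
    refine ⟨hs, not_le.2 ?_, ?_⟩
    · have h : (t.1 : ℝ) * N < gridDigit N (c N) t.2.1 := by
        rw [hdig N _ hN]
        exact mul_lt_mul_of_pos_right h1 hN'
      exact_mod_cast h
    · have h : (gridDigit N (c N) t.2.1 : ℝ) + 1 ≤ t.2.2 * N := by
        rw [hdig N _ hN]
        have := mul_lt_mul_of_pos_right h2 hN'
        rw [add_mul, one_div_mul_cancel hN'.ne'] at this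
        exact this.le
      exact_mod_cast h

theorem mem_finiteCovers_compatibleMeasures_iff
    (hq : ∀ s n, (q (s, n) : ℝ) ≤ (φ s).fst) (hr : ∀ s n, (r (s, n) : ℝ) ≤ -((φ s).snd : ℝ))
    (hq' : ∀ s, Tendsto (fun n => (q (s, n) : ℝ)) atTop (nhds (φ s).fst))
    (hr' : ∀ s, Tendsto (fun n => (r (s, n) : ℝ)) atTop (nhds (-((φ s).snd : ℝ))))
    (L : List (List (ℚ × Situation × ℚ))) :
    (L.map List.toFinset).toFinset ∈ finiteCovers (compatibleMeasures φ) ↔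
      ∃ N, GridCovers q r L N := by
  have hL : (L.map List.toFinset).toFinset ∈ finiteCovers (compatibleMeasures φ) ↔
      ∀ μ, IsCompatible φ (cylinderMass μ) → ∃ b ∈ L, ∀ t ∈ b,
        (t.1 : ℝ) < cylinderMass μ t.2.1 ∧ cylinderMass μ t.2.1 < t.2.2 := by
    simp only [finiteCovers, Set.mem_ofPred_eq, Set.subset_def, mem_compatibleMeasures_iff]
    refine forall₂_congr fun μ _ => ?_
    simp [mem_basicOpen]
  rw [hL]
  constructor
  · intro h
    -- Each failing `N` supplies a grid point `c N`. The limit of these points lies in some `b` of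
    -- the cover, which is finite, so one `N` puts `c N` inside all constraints of `b`.
    by_contra! hN
    simp only [GridCovers] at hN
    push Not at hN
    choose c _ hviol hin using hN
    obtain ⟨v, hv, hvt⟩ := exists_isCompatible_of_forall_grid hq' hr' c hviol
    obtain ⟨μ, hμ⟩ := hv.1.exists_measure
    obtain rfl : cylinderMass μ = v := funext hμ
    obtain ⟨b, hb, hbt⟩ := h μ hv
    have hev : ∀ᶠ N in (hyperfilter ℕ : Filter ℕ), ∀ t ∈ b.toFinset, GridInside N (c N) t :=
      (eventually_all_finset _).2 fun t ht =>
        hvt t (hbt t (List.mem_toFinset.1 ht)).1 (hbt t (List.mem_toFinset.1 ht)).2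
    obtain ⟨N, hN⟩ := hev.exists
    obtain ⟨t, ht, hnt⟩ := hin N b hb
    exact hnt (hN t (List.mem_toFinset.2 ht))
  · rintro ⟨N, hN⟩ μ hμ
    obtain ⟨c, hc, hviol, hin⟩ := hμ.exists_grid hq hr N
    rcases hN c hc with ⟨s, hs⟩ | ⟨b, hb, hbt⟩
    · exact absurd hs (hviol s)
    · exact ⟨b, hb, fun t ht => hin t (hbt t ht)⟩

end GridCriterion

/-! ### Recursive enumerability of the finite covers -/

theorem primrec_nat_pow : Primrec₂ fun a b : ℕ => a ^ b := by
  refine (Primrec.nat_rec' (f := fun p : ℕ × ℕ => p.2) (g := fun _ => 1)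
    (h := fun p q => q.2 * p.1) Primrec.snd (Primrec.const 1) ?_).of_eq fun p => ?_
  · exact Primrec.nat_mul.comp (Primrec.snd.comp Primrec.snd) (Primrec.fst.comp Primrec.fst)
  · obtain ⟨a, b⟩ := p
    induction b with
    | zero => rfl
    | succ b ih => exact congrArg (· * a) ih

theorem primrec_gridDigit :
    Primrec fun p : (ℕ × ℕ) × Situation => gridDigit p.1.1 p.1.2 p.2 := by
  have hN : Primrec fun p : (ℕ × ℕ) × Situation => p.1.1 + 1 :=
    Primrec.succ.comp (Primrec.fst.comp Primrec.fst)
  exact Primrec.nat_mod.comp (Primrec.nat_div.comp (Primrec.snd.comp Primrec.fst)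
    (primrec_nat_pow.comp hN (Primrec.encode.comp Primrec.snd))) hN

theorem primrecPred_gridInside :
    PrimrecPred fun p : (ℕ × ℕ) × (ℚ × Situation × ℚ) => GridInside p.1.1 p.1.2 p.2 := by
  have hN : Primrec fun p : (ℕ × ℕ) × (ℚ × Situation × ℚ) => p.1.1 := Primrec.fst.comp Primrec.fst
  have hs : Primrec fun p : (ℕ × ℕ) × (ℚ × Situation × ℚ) => p.2.2.1 :=
    Primrec.fst.comp (Primrec.snd.comp Primrec.snd)
  have hd : Primrec fun p : (ℕ × ℕ) × (ℚ × Situation × ℚ) => gridDigit p.1.1 p.1.2 p.2.2.1 :=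
    primrec_gridDigit.comp (Primrec.fst.pair hs)
  exact (Primrec.nat_lt.comp (Primrec.encode.comp hs) hN).and
    ((primrecPred_natCast_le_mul.comp
      ((Primrec.fst.comp Primrec.snd).pair (hd.pair hN))).not.and
    (primrecPred_natCast_le_mul.comp
      ((Primrec.snd.comp (Primrec.snd.comp Primrec.snd)).pair ((Primrec.succ.comp hd).pair hN))))

theorem primrecPred_exists_forall_gridInside :
    PrimrecPred fun p : List (List (ℚ × Situation × ℚ)) × (ℕ × ℕ) =>
      ∃ b ∈ p.1, ∀ t ∈ b, GridInside p.2.1 p.2.2 t := by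
  have h : PrimrecRel fun (t : ℚ × Situation × ℚ) (p : ℕ × ℕ) => GridInside p.1 p.2 t :=
    primrecPred_gridInside.comp (Primrec.snd.pair Primrec.fst)
  exact h.forall_mem_list.exists_mem_list

theorem primrecPred_gridViolates :
    PrimrecPred fun p : (ℚ × ℚ) × (ℕ × ℕ) × Situation =>
      GridViolates p.1.1 p.1.2 p.2.1.1 p.2.1.2 p.2.2 := by
  have hN : Primrec fun p : (ℚ × ℚ) × (ℕ × ℕ) × Situation => p.2.1.1 :=
    Primrec.fst.comp (Primrec.fst.comp Primrec.snd)
  have hs : Primrec fun p : (ℚ × ℚ) × (ℕ × ℕ) × Situation => p.2.2 :=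
    Primrec.snd.comp Primrec.snd
  have hchild : ∀ x : Bool, Primrec fun p : (ℚ × ℚ) × (ℕ × ℕ) × Situation => p.2.2 ++ [x] :=
    fun x => Primrec.list_append.comp hs (Primrec.const [x])
  have hd : Primrec fun p : (ℚ × ℚ) × (ℕ × ℕ) × Situation => gridDigit p.2.1.1 p.2.1.2 p.2.2 :=
    primrec_gridDigit.comp Primrec.snd
  have hdc : ∀ x : Bool, Primrec fun p : (ℚ × ℚ) × (ℕ × ℕ) × Situation =>
      gridDigit p.2.1.1 p.2.1.2 (p.2.2 ++ [x]) := fun x =>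
    primrec_gridDigit.comp ((Primrec.fst.comp Primrec.snd).pair (hchild x))
  have hlt : ∀ {f : (ℚ × ℚ) × (ℕ × ℕ) × Situation → Situation}, Primrec f →
      PrimrecPred fun p => encode (f p) < p.2.1.1 := fun hf =>
    Primrec.nat_lt.comp (Primrec.encode.comp hf) hN
  have hsum := Primrec.nat_add.comp (hdc false) (hdc true)
  exact ((hlt hs).and ((hlt (hchild false)).and (hlt (hchild true)))).and
    (((Primrec.eq.comp (Primrec.list_length.comp hs) (Primrec.const 0)).and
      (Primrec.eq.comp hd hN).not).or
    ((Primrec.nat_lt.comp (Primrec.succ.comp hsum) hd).or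
    ((Primrec.nat_lt.comp hd hsum).or
    ((primrecPred_natCast_le_mul.comp
      ((Primrec.fst.comp Primrec.fst).pair ((Primrec.succ.comp (hdc true)).pair hd))).or
    (primrecPred_natCast_add_mul_pos.comp
      ((Primrec.snd.comp Primrec.fst).pair ((hdc true).pair (Primrec.succ.comp hd))))))))

section

variable {q r : Situation × ℕ → ℚ}

theorem exists_computable_gridViolates (hq : Computable q) (hr : Computable r) :
    ∃ F : (ℕ × ℕ) × Situation → Bool, Computable F ∧
      ∀ N c s, F ((N, c), s) = true ↔ GridViolates (q (s, N)) (r (s, N)) N c s := by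
  obtain ⟨_, hF⟩ := primrecPred_gridViolates
  have hsN : Computable fun p : (ℕ × ℕ) × Situation => (p.2, p.1.1) :=
    Computable.snd.pair (Computable.fst.comp Computable.fst)
  exact ⟨_, hF.to_comp.comp (((hq.comp hsN).pair (hr.comp hsN)).pair Computable.id),
    fun N c s => decide_eq_true_iff⟩

theorem exists_computable_exists_gridViolates (hq : Computable q) (hr : Computable r) :
    ∃ F : ℕ × ℕ → Bool, Computable F ∧
      ∀ N c, F (N, c) = true ↔ ∃ s, GridViolates (q (s, N)) (r (s, N)) N c s := by
  obtain ⟨F, hF, hFiff⟩ := exists_computable_gridViolates hq hr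
  -- A violating situation has code below `N`, so testing `i < N` suffices. The default `[]` is
  -- harmless, since any positive answer exhibits a genuine violation.
  have h : Computable₂ fun (p : ℕ × ℕ) (i : ℕ) => !F (p, (decode (α := Situation) i).getD []) :=
    Primrec.not.to_comp.comp (hF.comp (Computable.fst.pair
      ((Primrec.option_getD.comp (Primrec.decode.comp Primrec.snd) (Primrec.const [])).to_comp)))
  refine ⟨_, Primrec.not.to_comp.comp ((computable_forall_lt h).comp Computable.id
    Computable.fst), fun N c => ?_⟩
  simp only [Bool.not_eq_true', decide_eq_false_iff_not, id, not_forall, Bool.not_eq_false, hFiff]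
  constructor
  · rintro ⟨i, _, hi⟩
    exact ⟨_, hi⟩
  · rintro ⟨s, hs⟩
    exact ⟨encode s, hs.1.1, by simpa using hs⟩

theorem rePred_exists_gridCovers (hq : Computable q) (hr : Computable r) :
    REPred fun L => ∃ N, GridCovers q r L N := by
  obtain ⟨F, hF, hFiff⟩ := exists_computable_exists_gridViolates hq hr
  obtain ⟨_, hG⟩ := primrecPred_exists_forall_gridInside
  have hNc : Computable fun p : (List (List (ℚ × Situation × ℚ)) × ℕ) × ℕ => (p.1.2, p.2) :=
    (Computable.snd.comp Computable.fst).pair Computable.snd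
  have h := computable_forall_lt (Computable.to₂ (Primrec.or.to_comp.comp (hF.comp hNc)
    (hG.to_comp.comp ((Computable.fst.comp Computable.fst).pair hNc))))
  have hpow : Computable fun a : List (List (ℚ × Situation × ℚ)) × ℕ => (a.2 + 1) ^ a.2 :=
    (primrec_nat_pow.comp (Primrec.succ.comp Primrec.snd) Primrec.snd).to_comp
  refine (rePred_exists_of_computable (h.comp Computable.id hpow).to₂).of_eq fun L =>
    exists_congr fun N => ?_
  simp only [GridCovers, id, decide_eq_true_eq, Bool.or_eq_true, hFiff]

end

theorem LowerSemicomputable.exists_le {D : Type*} [Primcodable D] {f : D → ℝ}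
    (hf : LowerSemicomputable f) : ∃ q : D × ℕ → ℚ, Computable q ∧
      (∀ d n, (q (d, n) : ℝ) ≤ f d) ∧ ∀ d, Tendsto (fun n => (q (d, n) : ℝ)) atTop (nhds (f d)) := by
  obtain ⟨q, hq, hmono, hlim⟩ := hf
  refine ⟨q, hq, fun d n => ?_, hlim⟩
  exact (monotone_nat_of_le_succ fun n => Rat.cast_le.2 (hmono d n)).ge_of_tendsto (hlim d) n

theorem effectivelyCompact_compatibleMeasures {φ : ForecastingSystem} (hφ : φ.IsComputable) :
    EffectivelyCompact (compatibleMeasures φ) := by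
  obtain ⟨q, hq, hqle, hqlim⟩ := hφ.1.1.exists_le
  obtain ⟨r, hr, hrle, hrlim⟩ := LowerSemicomputable.exists_le hφ.2.2
  exact ⟨isCompact_compatibleMeasures φ, (rePred_exists_gridCovers hq hr).of_eq fun L =>
    (mem_finiteCovers_compatibleMeasures_iff hqle hrle hqlim hrlim L).symm⟩

/-! ### Martin-Löf tests and uniform tests -/

theorem rePred_comp {α β : Type*} [Primcodable α] [Primcodable β] {p : β → Prop} (hp : REPred p)
    {g : α → β} (hg : Computable g) : REPred fun a => p (g a) :=
  Partrec.comp hp hg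

/-- By Markov's inequality the open set where `τ` exceeds `2 ^ n` has probability at most `2⁻¹ ^ n`
under each compatible measure, hence has upper probability at most that. A path with `τ ω = ∞` lies
in all these sets. -/
theorem martinLofTestRandom_imp {φ : ForecastingSystem} {ω : Path}
    (hω : MartinLofTestRandom φ ω) : UniformlyRandom (compatibleMeasures φ) ω := by
  rintro τ ⟨⟨B, hB, hBτ⟩, hint⟩
  by_contra hτ
  rw [not_lt_top_iff] at hτ
  let A : Set (ℕ × Situation) := {p | (((2 ^ p.1 : ℕ) : ℚ), p.2) ∈ B}
  have hcyl : ∀ n, cylinders {s | (n, s) ∈ A} = {η | ENNReal.ofReal (2 ^ n) < τ η} := by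
    intro n
    have h := hBτ ((2 ^ n : ℕ) : ℚ)
    refine h.symm.trans (Set.ext fun η => ?_)
    simp only [Set.mem_ofPred_eq]
    rw [← EReal.coe_ennreal_lt_coe_ennreal_iff, EReal.coe_ennreal_ofReal,
      max_eq_left (by positivity)]
    push_cast
    rfl
  refine hω A ⟨?_, fun n => ?_⟩ (Set.mem_iInter.2 fun n => ?_)
  · refine rePred_comp hB (g := fun p : ℕ × Situation => (((2 ^ p.1 : ℕ) : ℚ), p.2)) ?_
    exact ((primrec_natCast_rat.comp (primrec_nat_pow.comp (Primrec.const 2) Primrec.fst)).pair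
      Primrec.snd).to_comp
  · refine upperProb_cylinders_le_of_forall φ _ fun μ hμ => ?_
    have h1 := hint μ (mem_compatibleMeasures_iff.2 hμ)
    have hE : MeasurableSet (cylinders {s | (n, s) ∈ A}) := (isOpen_cylinders _).measurableSet
    have h2 : ENNReal.ofReal (2 ^ n) * (μ : Measure Path) (cylinders {s | (n, s) ∈ A}) ≤ 1 := by
      rw [← lintegral_indicator_const hE]
      refine le_trans (lintegral_mono (Set.indicator_le fun η hη => ?_)) h1
      rw [hcyl] at hη
      exact hη.le
    have h3 := ENNReal.toReal_mono ENNReal.one_ne_top h2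
    rw [ENNReal.toReal_mul, ENNReal.toReal_ofReal (by positivity), ENNReal.toReal_one] at h3
    rw [inv_pow, ← one_div, le_div_iff₀' (by positivity)]
    exact h3
  · rw [hcyl, Set.mem_ofPred_eq, hτ]
    exact ENNReal.ofReal_lt_top

/-- The supremum of the numbers `2 ^ n` for which the set with index `2 * n + 1` contains `ω`. -/
noncomputable def testFunction (U : ℕ → Set Path) (ω : Path) : ℝ≥0∞ :=
  ⨆ n, (U (2 * n + 1)).indicator (fun _ => 2 ^ n) ω

/-- Only odd indices are used because `2 ^ n * 2⁻¹ ^ (2 * n + 1) = 2⁻¹ ^ (n + 1)`, and these bounds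
sum to exactly one. -/
theorem lintegral_testFunction_le {U : ℕ → Set Path} {μ : Measure Path}
    (hU : ∀ n, MeasurableSet (U n)) (hμ : ∀ n, μ (U n) ≤ 2⁻¹ ^ n) :
    ∫⁻ ω, testFunction U ω ∂μ ≤ 1 := by
  calc ∫⁻ ω, testFunction U ω ∂μ
      ≤ ∫⁻ ω, ∑' n, (U (2 * n + 1)).indicator (fun _ => (2 : ℝ≥0∞) ^ n) ω ∂μ :=
        lintegral_mono fun ω => iSup_le fun n => ENNReal.le_tsum n
    _ = ∑' n, 2 ^ n * μ (U (2 * n + 1)) := by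
        rw [lintegral_tsum fun n => (measurable_const.indicator (hU _)).aemeasurable]
        exact tsum_congr fun n => lintegral_indicator_const (hU _) _
    _ ≤ ∑' n, 2⁻¹ ^ (n + 1) := by
        refine ENNReal.tsum_le_tsum fun n => (mul_le_mul_right (hμ _) _).trans_eq ?_
        rw [show 2 * n + 1 = n + (n + 1) by ring, pow_add, ← mul_assoc, ← mul_pow,
          ENNReal.mul_inv_cancel (by simp) (by simp), one_pow, one_mul]
    _ = 1 := by
        rw [ENNReal.tsum_geometric_add_one, ENNReal.one_sub_inv_two, inv_inv,
          ENNReal.inv_mul_cancel (by simp) (by simp)]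

theorem coe_lt_testFunction_iff {U : ℕ → Set Path} {r : ℚ} {ω : Path} :
    (((r : ℚ) : ℝ) : EReal) < ((testFunction U ω : ℝ≥0∞) : EReal) ↔
      r < 0 ∨ ∃ n, r < (2 ^ n : ℕ) ∧ ω ∈ U (2 * n + 1) := by
  rcases lt_or_ge r 0 with hr | hr
  · refine iff_of_true (lt_of_lt_of_le ?_ (EReal.coe_ennreal_nonneg _)) (Or.inl hr)
    exact_mod_cast hr
  · have hr' : (0 : ℝ) ≤ r := by exact_mod_cast hr
    have h : ((r : ℝ) : EReal) = ((ENNReal.ofReal r : ℝ≥0∞) : EReal) := by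
      rw [EReal.coe_ennreal_ofReal, max_eq_left hr']
    rw [h, EReal.coe_ennreal_lt_coe_ennreal_iff, testFunction, lt_iSup_iff]
    simp only [hr.not_gt, false_or]
    refine exists_congr fun n => ?_
    by_cases hω : ω ∈ U (2 * n + 1)
    · rw [Set.indicator_of_mem hω]
      have h2 : (2 : ℝ≥0∞) ^ n = ENNReal.ofReal (2 ^ n) := by simp
      rw [h2, ENNReal.ofReal_lt_ofReal_iff (by positivity)]
      simp only [hω, and_true]
      exact_mod_cast Iff.rfl
    · simp [hω]

theorem effectivelyOpenIn_testFunction {A : Set (ℕ × Situation)} (hA : IsRE A) :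
    EffectivelyOpenIn fun r : ℚ => {ω | (((r : ℚ) : ℝ) : EReal) <
      ((testFunction (fun n => cylinders {s | (n, s) ∈ A}) ω : ℝ≥0∞) : EReal)} := by
  classical
  refine ⟨{p | p.1 < 0 ∨ ∃ n, p.1 < (2 ^ n : ℕ) ∧ (2 * n + 1, p.2) ∈ A}, ?_, fun r => ?_⟩
  · obtain ⟨f, hf, hfA⟩ := exists_computable_of_rePred hA
    have hneg : PrimrecPred fun p : (ℚ × Situation) × ℕ => ¬((0 : ℕ) : ℚ) ≤ p.1.1 * (1 : ℕ) :=
      (primrecPred_natCast_le_mul.comp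
        ((Primrec.fst.comp Primrec.fst).pair (Primrec.const (0, 1)))).not
    have hlt : PrimrecPred fun p : (ℚ × Situation) × ℕ =>
        ¬((2 ^ p.2.unpair.1 : ℕ) : ℚ) ≤ p.1.1 * (1 : ℕ) :=
      (primrecPred_natCast_le_mul.comp ((Primrec.fst.comp Primrec.fst).pair
        ((primrec_nat_pow.comp (Primrec.const 2)
          (Primrec.fst.comp (Primrec.unpair.comp Primrec.snd))).pair (Primrec.const 1)))).not
    have hA' : Computable fun p : (ℚ × Situation) × ℕ =>
        f (2 * p.2.unpair.1 + 1, p.1.2) p.2.unpair.2 := by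
      refine hf.comp (Primrec.to_comp (Primrec.pair ?_ (Primrec.snd.comp Primrec.fst)))
        (Primrec.snd.comp (Primrec.unpair.comp Primrec.snd)).to_comp
      exact Primrec.succ.comp (Primrec.nat_mul.comp (Primrec.const 2)
        (Primrec.fst.comp (Primrec.unpair.comp Primrec.snd)))
    -- The number `m` encodes a pair: an index `n` and a search stage for membership in `A`. The
    -- factor `1` fits the comparisons with `r` to the available predicate.
    have h : Computable₂ fun (p : ℚ × Situation) (m : ℕ) =>
        (decide (¬((0 : ℕ) : ℚ) ≤ p.1 * (1 : ℕ)) ||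
          (decide (¬((2 ^ m.unpair.1 : ℕ) : ℚ) ≤ p.1 * (1 : ℕ)) &&
            f (2 * m.unpair.1 + 1, p.2) m.unpair.2)) :=
      Primrec.or.to_comp.comp hneg.decide.to_comp
        (Primrec.and.to_comp.comp hlt.decide.to_comp hA')
    refine (rePred_exists_of_computable h).of_eq fun p => ?_
    simp only [Bool.or_eq_true, Bool.and_eq_true, decide_eq_true_eq, Nat.cast_one, mul_one,
      Nat.cast_zero, not_le, exists_or, exists_const, Set.mem_ofPred_eq]
    refine or_congr_right ⟨?_, ?_⟩
    · rintro ⟨m, h1, h2⟩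
      exact ⟨_, h1, (hfA _).2 ⟨_, h2⟩⟩
    · rintro ⟨n, h1, h2⟩
      obtain ⟨k, hk⟩ := (hfA _).1 h2
      exact ⟨Nat.pair n k, by simpa using h1, by simpa using hk⟩
  · ext ω
    rw [Set.mem_ofPred_eq, coe_lt_testFunction_iff, mem_cylinders]
    simp only [mem_cylinders, Set.mem_ofPred_eq]
    constructor
    · rintro (h | ⟨n, h1, m, h2⟩)
      -- For negative `r` all situations are enumerated, so the empty one already covers every path.
      · exact ⟨0, Or.inl h⟩
      · exact ⟨m, Or.inr ⟨n, h1, h2⟩⟩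
    · rintro ⟨m, h | ⟨n, h1, h2⟩⟩
      · exact Or.inl h
      · exact Or.inr ⟨n, h1, m, h2⟩

/-- A path in all sets of the test makes `testFunction` at least `2 ^ n` for every `n`, hence
infinite. The integral bound holds since compatible measures lie below the upper probability. -/
theorem uniformlyRandom_imp {φ : ForecastingSystem} {ω : Path}
    (hω : UniformlyRandom (compatibleMeasures φ) ω) : MartinLofTestRandom φ ω := by
  rintro A ⟨hA, hAφ⟩ hωA
  have h := hω _ ⟨effectivelyOpenIn_testFunction hA, fun μ hμ => ?_⟩
  · refine h.ne (top_unique (le_of_tendsto' (ENNReal.tendsto_pow_atTop_nhds_top_iff.2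
      ENNReal.one_lt_two) fun n => ?_))
    refine le_iSup_of_le n ?_
    rw [Set.indicator_of_mem (Set.mem_iInter.1 hωA _)]
  · refine lintegral_testFunction_le (fun n => (isOpen_cylinders _).measurableSet) fun n => ?_
    have h1 := ((mem_compatibleMeasures_iff.1 hμ).measure_le_upperProb
      (isOpen_cylinders {s | (n, s) ∈ A}).measurableSet).trans (hAφ n)
    rw [← ENNReal.ofReal_le_ofReal_iff (by positivity), ofReal_measureReal] at h1
    refine h1.trans_eq ?_
    rw [ENNReal.ofReal_pow (by positivity), ENNReal.ofReal_inv_of_pos two_pos, ENNReal.ofReal_ofNat]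

end ImpreciseRandomness

theorem mainTheorem3 (φ : ImpreciseRandomness.ForecastingSystem) (hφ : φ.IsComputable) :
    ImpreciseRandomness.EffectivelyCompact (ImpreciseRandomness.compatibleMeasures φ) ∧
      ∀ ω : ImpreciseRandomness.Path,
        ImpreciseRandomness.MartinLofTestRandom φ ω ↔
          ImpreciseRandomness.UniformlyRandom (ImpreciseRandomness.compatibleMeasures φ) ω :=
  ⟨ImpreciseRandomness.effectivelyCompact_compatibleMeasures hφ, fun _ =>
    ⟨ImpreciseRandomness.martinLofTestRandom_imp, ImpreciseRandomness.uniformlyRandom_imp⟩⟩
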